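/- Let $g$ be a smooth Lorentzian metric of signature $(-,+,+,+)$ on a smooth $4$-manifold, with Ricci tensor $R$, and let $k>0$. Units are such that $c=8\pi G=1$. For a symmetric 2-tensor $S$, $S^2$ has components $(S^2)_{\alpha\beta}=S_\alpha{}^\lambda S_{\lambda\beta}$, $S(x)$ is the vector with covariant components $S_{\alpha\beta}x^\beta$, and indices are raised and lowered with $g$. Put $$t=\operatorname{tr}R,\quad N=R-\tfrac14 t\,g,\quad q=-2\sqrt[3]{\tfrac13\operatorname{tr}N^3},\quad Q=N-\tfrac14 q\,g,\quad \rho=\tfrac14(3q+t),\quad p=\tfrac14(q-t),$$ $$\pi=\frac p\rho,\qquad \chi=\frac{Q(d p,d\rho)}{Q(d\rho,d\rho)},\qquad \chi'=\frac{(d\chi,y)}{(d\pi,y)},$$ where $y$ is any vector with $(d\pi,y)\neq0$. A *generic ideal gas in local thermal equilibrium (l.t.e.)* is given by smooth functions of state on an open part of the thermodynamic plane: matter density $r>0$, specific internal energy $\epsilon$, temperature $\Theta>0$, specific entropy $s$ and pressure $p$, with $\Theta\,ds=d\epsilon+p\,dv$, $v=1/r$, and $p=kr\Theta$; $(s,p)$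 are coordinates of the plane, and the gas is not barotropic: $d\rho\wedge dp\neq0$ on the plane, where $\rho=r(1+\epsilon)$. Its dynamic volume is $\tau=(1+\epsilon+pv)v$, and the relativistic compressibility conditions are, at every state, ${\rm H}_1$: $(\tau'_p)_s<0$ and $(\tau''_p)_s>0$; ${\rm H}_2$: $(\tau'_s)_p>0$. The metric $g$ is a *non-isoenergetic perfect fluid solution modeling an ideal gas in l.t.e. that fulfills ${\rm H}_1$ and ${\rm H}_2$* if around every point there are a smooth unit time-like vector field $u$, smooth functions $\rho$, $p$, $s$, and a generic ideal gas fulfilling ${\rm H}_1$ and ${\rm H}_2$, such that the Einstein equations $R-\frac12(\operatorname{tr}R)\,g=(\rho+p)\,u\otimes u+p\,g$ hold, the energy conditions for a gas $0\le p<\rho$ hold, the state $(s,p)$ is at each point a state of the gas, with energy density $\rho$, matter is conserved, $u(r)+r\,\nabla\!\cdot u=0$, and $u(\rho)\neq0$ everywhere. **Theorem.** The metric $g$ is a non-isoenergetic perfect fluid solution modeling an ideal gas in l.t.e. that fulfills the compressibility conditions ${\rm H}_1$ and ${\rm H}_2$ if, and only if, at every point its Ricci tensor satisfies $$Q^2+q\,Q=0,\qquad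 Q(x,x)>0\ \text{ for every time-like vector } x,\qquad -q<t\le q,$$ $$Q(d\rho)\neq0,\qquad d\chi\wedge d\pi=0,\qquad \chi\neq\pi,$$ $$\frac{\pi}{2\pi+1}<\chi<1,\qquad (1+\pi)(\chi-\pi)\,\chi'+2\chi(1-\chi)>0 .$$ -/

import Mathlib

open scoped Manifold ContDiff

noncomputable section

namespace Rainich

/-! ### Metrics, Ricci tensor and its concomitants in a coordinate domain -/

/-- The coordinate space `ℝ⁴`. -/
abbrev E4 : Type := EuclideanSpace ℝ (Fin 4)

/-- A field of `4 × 4` matrices: the components of a 2-tensor field in coordinates. -/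
abbrev Tensor2 : Type := E4 → Matrix (Fin 4) (Fin 4) ℝ

/-- The coordinate partial derivative `∂ᵢ f`. -/
def pd (i : Fin 4) (f : E4 → ℝ) (x : E4) : ℝ :=
  fderiv ℝ f x (EuclideanSpace.single i 1)

/-- The components `∂ᵢ f` of the differential `df`. -/
def dif (f : E4 → ℝ) (x : E4) : Fin 4 → ℝ := fun i => pd i f x

/-- Christoffel symbols
`Γˡᵢⱼ = ½ gˡᵐ (∂ᵢ gₘⱼ + ∂ⱼ gₘᵢ - ∂ₘ gᵢⱼ)` of the Levi-Civita connection. -/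
def christoffel (g : Tensor2) (l i j : Fin 4) (x : E4) : ℝ :=
  (1 / 2) * ∑ m, (g x)⁻¹ l m *
    (pd i (fun y => g y m j) x + pd j (fun y => g y m i) x - pd m (fun y => g y i j) x)

/-- Ricci tensor
`Rᵢⱼ = ∂ₗ Γˡᵢⱼ - ∂ⱼ Γˡᵢₗ + Γˡₗₘ Γᵐᵢⱼ - Γˡⱼₘ Γᵐᵢₗ`. -/
def ricci (g : Tensor2) (x : E4) : Matrix (Fin 4) (Fin 4) ℝ :=
  Matrix.of fun i j =>
    (∑ l, pd l (christoffel g l i j) x) - (∑ l, pd j (christoffel g l i l) x)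
      + (∑ l, ∑ m, christoffel g l l m x * christoffel g m i j x)
      - (∑ l, ∑ m, christoffel g l j m x * christoffel g m i l x)

/-- The divergence `∇ₐ uᵃ = ∂ₐ uᵃ + Γᵃₐᵦ uᵇ` of a vector field. -/
def divergence (g : Tensor2) (u : E4 → Fin 4 → ℝ) (x : E4) : ℝ :=
  (∑ a, pd a (fun y => u y a) x) + ∑ a, ∑ b, christoffel g a a b x * u x b

/-- The derivative `u(f) = uᵃ ∂ₐ f` of a function along a vector field. -/
def along (u : E4 → Fin 4 → ℝ) (f : E4 → ℝ) (x : E4) : ℝ :=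
  ∑ a, u x a * pd a f x

/-- The value `S(v, w) = Sᵢⱼ vⁱ wʲ` of a 2-covariant tensor on two vectors. -/
def bil (S : Matrix (Fin 4) (Fin 4) ℝ) (v w : Fin 4 → ℝ) : ℝ :=
  ∑ i, ∑ j, S i j * v i * w j

/-- The vector obtained from a covector by raising the index. -/
def raise (g : Tensor2) (x : E4) (α : Fin 4 → ℝ) : Fin 4 → ℝ :=
  fun i => ∑ j, (g x)⁻¹ i j * α j

/-- The real cube root. -/
def cbrt (a : ℝ) : ℝ := Real.sign a * |a| ^ ((1 : ℝ) / 3)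

theorem cbrt_pow_three (a : ℝ) : cbrt a ^ 3 = a := by
  have h : (|a| ^ ((1 : ℝ) / 3)) ^ 3 = |a| := by
    rw [← Real.rpow_natCast, ← Real.rpow_mul (abs_nonneg a)]
    norm_num
  unfold cbrt
  rw [mul_pow, h]
  rcases lt_trichotomy a 0 with ha | ha | ha
  · rw [Real.sign_of_neg ha, abs_of_neg ha]; ring
  · simp [ha]
  · rw [Real.sign_of_pos ha, abs_of_pos ha]; ring

/-- `t = tr R = gⁱʲ Rᵢⱼ`. -/
def tS (g : Tensor2) (x : E4) : ℝ := ((g x)⁻¹ * ricci g x).trace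

/-- `N = R - ¼ t g`. -/
def tN (g : Tensor2) (x : E4) : Matrix (Fin 4) (Fin 4) ℝ :=
  ricci g x - (tS g x / 4) • g x

/-- `q = -2 ∛(tr N³ / 3)`; the trace is that of the cube of the endomorphism `Nᵢʲ`. -/
def qS (g : Tensor2) (x : E4) : ℝ :=
  -2 * cbrt ((((g x)⁻¹ * tN g x) ^ 3).trace / 3)

/-- `Q = N - ¼ q g`. -/
def tQ (g : Tensor2) (x : E4) : Matrix (Fin 4) (Fin 4) ℝ :=
  tN g x - (qS g x / 4) • g x

/-- `ρ = ¼ (3 q + t)`. -/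
def rhoS (g : Tensor2) (x : E4) : ℝ := (3 * qS g x + tS g x) / 4

/-- `p = ¼ (q - t)`. -/
def pS (g : Tensor2) (x : E4) : ℝ := (qS g x - tS g x) / 4

/-- `π = p / ρ`. -/
def piS (g : Tensor2) (x : E4) : ℝ := pS g x / rhoS g x

/-- `χ = Q(dp, dρ) / Q(dρ, dρ)`. -/
def chiS (g : Tensor2) (x : E4) : ℝ :=
  bil (tQ g x) (raise g x (dif (pS g) x)) (raise g x (dif (rhoS g) x)) /
    bil (tQ g x) (raise g x (dif (rhoS g) x)) (raise g x (dif (rhoS g) x))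

/-- The Rainich conditions, at the point `x` of a coordinate domain, for a non isoenergetic
ideal gas fulfilling the relativistic compressibility conditions. -/
structure RainichConditions (g : Tensor2) (x : E4) : Prop where
  /-- `Q² + q Q = 0`, with `(Q²)ᵢⱼ = Qᵢˡ Qₗⱼ`. -/
  algebraic : tQ g x * (g x)⁻¹ * tQ g x + qS g x • tQ g x = 0
  /-- `Q(v, v) > 0` for every time-like vector `v`. -/
  timelike_pos : ∀ v : Fin 4 → ℝ, bil (g x) v v < 0 → 0 < bil (tQ g x) v v
  /-- `-q < t ≤ q`, that is `0 ≤ p < ρ`. -/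
  neg_q_lt_t : -qS g x < tS g x
  t_le_q : tS g x ≤ qS g x
  /-- `Q(dρ) ≠ 0`. -/
  Q_drho_ne : (tQ g x).mulVec (raise g x (dif (rhoS g) x)) ≠ 0
  /-- `dχ ∧ dπ = 0`. -/
  wedge : ∀ i j, pd i (chiS g) x * pd j (piS g) x - pd j (chiS g) x * pd i (piS g) x = 0
  /-- `χ ≠ π`. -/
  chi_ne_pi : chiS g x ≠ piS g x
  /-- `π / (2π + 1) < χ < 1`. -/
  lt_chi : piS g x / (2 * piS g x + 1) < chiS g x
  chi_lt_one : chiS g x < 1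
  /-- `(1 + π)(χ - π) χ' + 2 χ (1 - χ) > 0`, where `χ' = (dχ, y) / (dπ, y)` for any vector `y`
  with `(dπ, y) ≠ 0`. -/
  chi_prime : ∀ y : Fin 4 → ℝ, ∑ i, y i * pd i (piS g) x ≠ 0 →
    0 < (1 + piS g x) * (chiS g x - piS g x) *
        ((∑ i, y i * pd i (chiS g) x) / (∑ i, y i * pd i (piS g) x))
      + 2 * chiS g x * (1 - chiS g x)

/-! ### Generic ideal gases -/

/-- The thermodynamics of a (non barotropic) generic ideal gas in local thermal equilibrium, with
gas constant `k`.  The thermodynamic plane is described by the specific entropy and the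
pressure: a state is a pair `w = (s, p)`. -/
structure IdealGas (k : ℝ) where
  /-- The admissible states `(s, p)`. -/
  dom : Set (ℝ × ℝ)
  /-- The matter density. -/
  r : ℝ × ℝ → ℝ
  /-- The specific internal energy. -/
  ε : ℝ × ℝ → ℝ
  /-- The temperature. -/
  Θ : ℝ × ℝ → ℝ
  isOpen_dom : IsOpen dom
  smooth_r : ContDiffOn ℝ ∞ r dom
  smooth_ε : ContDiffOn ℝ ∞ ε dom
  smooth_Θ : ContDiffOn ℝ ∞ Θ dom
  r_pos : ∀ w ∈ dom, 0 < r w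
  Θ_pos : ∀ w ∈ dom, 0 < Θ w
  /-- Local thermal equilibrium: `Θ ds = dε + p dv`, with `v = 1 / r`. -/
  balance : ∀ w ∈ dom, ∀ h : ℝ × ℝ,
    Θ w * h.1 = fderiv ℝ ε w h + w.2 * fderiv ℝ (fun w' => 1 / r w') w h
  /-- The equation of state `p = k r Θ`. -/
  ideal : ∀ w ∈ dom, w.2 = k * r w * Θ w
  /-- The medium is not barotropic: `dρ ∧ dp ≠ 0` on the thermodynamic plane, `ρ = r (1 + ε)`. -/
  nonbarotropic : ∀ w ∈ dom, deriv (fun s => r (s, w.2) * (1 + ε (s, w.2))) w.1 ≠ 0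

namespace IdealGas

variable {k : ℝ} (G : IdealGas k)

/-- The specific volume `v = 1 / r`. -/
def v (w : ℝ × ℝ) : ℝ := 1 / G.r w

/-- The energy density `ρ = r (1 + ε)`. -/
def ρ (w : ℝ × ℝ) : ℝ := G.r w * (1 + G.ε w)

/-- The dynamic volume `τ = f v`, where `f = 1 + i` is the enthalpy index and `i = ε + p v` the
specific enthalpy. -/
def τ (w : ℝ × ℝ) : ℝ := (1 + (G.ε w + w.2 * G.v w)) * G.v w

/-- The compressibility conditions `H₁`: `(τ'ₚ)ₛ < 0` and `(τ''ₚ)ₛ > 0`. -/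
def H1 : Prop :=
  ∀ w ∈ G.dom, deriv (fun p => G.τ (w.1, p)) w.2 < 0 ∧
    0 < deriv (deriv (fun p => G.τ (w.1, p))) w.2

/-- The compressibility condition `H₂`: `(τ'ₛ)ₚ > 0`. -/
def H2 : Prop :=
  ∀ w ∈ G.dom, 0 < deriv (fun s => G.τ (s, w.2)) w.1

end IdealGas

/-! ### Perfect fluid solutions -/

/-- On the open set `V` of the coordinate space, the metric `g` is a non isoenergetic solution of
the Einstein equations for the perfect fluid of unit velocity `u`, energy density `ρ` and pressure
`p` (units with `c = 8πG = 1`), which fulfills the energy conditions `0 ≤ p < ρ` for a gas and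
represents the evolution of the ideal gas `G`, `s` being its specific entropy. -/
structure IsIdealGasSolutionOn {k : ℝ} (G : IdealGas k) (g : Tensor2) (V : Set E4)
    (u : E4 → Fin 4 → ℝ) (ρ p s : E4 → ℝ) : Prop where
  smooth_u : ∀ a, ContDiffOn ℝ ∞ (fun x => u x a) V
  smooth_ρ : ContDiffOn ℝ ∞ ρ V
  smooth_p : ContDiffOn ℝ ∞ p V
  smooth_s : ContDiffOn ℝ ∞ s V
  /-- `g(u, u) = -1`. -/
  unit : ∀ x ∈ V, bil (g x) (u x) (u x) = -1
  /-- `R - ½ (tr R) g = (ρ + p) u ⊗ u + p g`. -/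
  einstein : ∀ x ∈ V, ricci g x - (tS g x / 2) • g x =
    (ρ x + p x) • Matrix.vecMulVec ((g x).mulVec (u x)) ((g x).mulVec (u x)) + p x • g x
  p_nonneg : ∀ x ∈ V, 0 ≤ p x
  p_lt_ρ : ∀ x ∈ V, p x < ρ x
  /-- The state of the fluid is an admissible state of the gas. -/
  state_mem : ∀ x ∈ V, (s x, p x) ∈ G.dom
  energy : ∀ x ∈ V, ρ x = G.ρ (s x, p x)
  /-- Conservation of matter: `u(r) + r ∇ₐ uᵃ = 0`. -/
  matter : ∀ x ∈ V,
    along u (fun y => G.r (s y, p y)) x + G.r (s x, p x) * divergence g u x = 0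
  /-- The evolution is non isoenergetic: `u(ρ) ≠ 0`. -/
  nonisoenergetic : ∀ x ∈ V, along u ρ x ≠ 0

/-- In a neighborhood of the point `x` of the coordinate domain `Ω`, the metric `g` is a
non isoenergetic perfect fluid solution modeling an ideal gas in local thermal equilibrium that
fulfills `H₁` and `H₂`. -/
def ModelsIdealGasNear (k : ℝ) (g : Tensor2) (Ω : Set E4) (x : E4) : Prop :=
  ∃ V : Set E4, IsOpen V ∧ x ∈ V ∧ V ⊆ Ω ∧
    ∃ (G : IdealGas k) (u : E4 → Fin 4 → ℝ) (ρ p s : E4 → ℝ),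
      G.H1 ∧ G.H2 ∧ IsIdealGasSolutionOn G g V u ρ p s

/-! ### Space-times -/

section Manifold

variable (M : Type*) [TopologicalSpace M] [ChartedSpace E4 M]

variable {M} in
/-- The coordinate vector field `∂ᵢ` of a chart `c`, at the point of coordinates `y`. -/
def coordVec (c : OpenPartialHomeomorph M E4) (y : E4) (i : Fin 4) :
    TangentSpace (𝓡 4) (c.symm y) :=
  mfderiv 𝓘(ℝ, E4) (𝓡 4) c.symm y
    (EuclideanSpace.single i (1 : ℝ) : TangentSpace 𝓘(ℝ, E4) y)

/-- A smooth Lorentzian metric of signature `(-,+,+,+)` on a smooth 4-manifold: a field of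
symmetric bilinear forms of that signature on the tangent spaces, whose components in every smooth
chart are smooth. -/
structure LorentzMetric where
  inner : ∀ x : M, TangentSpace (𝓡 4) x →ₗ[ℝ] TangentSpace (𝓡 4) x →ₗ[ℝ] ℝ
  symm : ∀ x v w, inner x v w = inner x w v
  signature : ∀ x, ∃ b : Module.Basis (Fin 4) ℝ (TangentSpace (𝓡 4) x),
    ∀ i j, inner x (b i) (b j) = Matrix.diagonal (![-1, 1, 1, 1] : Fin 4 → ℝ) i j
  smooth : ∀ c ∈ IsManifold.maximalAtlas (𝓡 4) ∞ M, ∀ i j : Fin 4,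
    ContDiffOn ℝ ∞ (fun y => inner (c.symm y) (coordVec c y i) (coordVec c y j)) c.target

variable {M}

/-- The components `gᵢⱼ = g(∂ᵢ, ∂ⱼ)` of a metric in a chart, as functions of the coordinates. -/
def LorentzMetric.coord (g : LorentzMetric M) (c : OpenPartialHomeomorph M E4) : Tensor2 :=
  fun y => Matrix.of fun i j => g.inner (c.symm y) (coordVec c y i) (coordVec c y j)

/-- The metric is (locally, around every point) a non isoenergetic perfect fluid solution modeling
an ideal gas in local thermal equilibrium that fulfills `H₁` and `H₂`. -/
def LorentzMetric.ModelsIdealGas (k : ℝ) (g : LorentzMetric M) : Prop :=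
  ∀ c ∈ IsManifold.maximalAtlas (𝓡 4) ∞ M, ∀ y ∈ c.target,
    ModelsIdealGasNear k (g.coord c) c.target y

/-- The Rainich conditions hold at every point; they are tensorial conditions, written in every
smooth chart. -/
def LorentzMetric.SatisfiesRainich (g : LorentzMetric M) : Prop :=
  ∀ c ∈ IsManifold.maximalAtlas (𝓡 4) ∞ M, ∀ y ∈ c.target,
    RainichConditions (g.coord c) y

end Manifold

end Rainich

end

noncomputable section

namespace Rainich

open Filter Topology Matrix

/-! ### Partial derivatives -/

/-! Everything is local, so the work is done with a Lorentzian matrix field on an open set of `ℝ⁴`.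

Direct implication. For a perfect fluid, `N` is `(ρ + p)(u ⊗ u + ¼ g)`, so the concomitants `q`,
`Q`, `rhoS`, `pS` return `ρ + p`, `(ρ + p) u ⊗ u`, `ρ`, `p`, and `χ = u(p)/u(ρ)`
(`concomitants_of_einstein`, `chiS_eq`). The contracted Bianchi identity along `u` is `u(ρ) + (ρ +
p)∇·u = 0`. Compared with conservation of matter through `dρ = ((ρ + p)/r) dr + rΘ ds`, it gives
`u(s) = 0`; hence `χ = 1/(ρ'ₚ)ₛ`, the squared speed of sound. The law `p = k r Θ` and the Maxwell
relation of the enthalpy make `p/ρ` and `(ρ'ₚ)ₛ` functions of the single variable `σ = s/k + ln p`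
(`fderiv_ρ_scaling`, `fderiv_ρp_scaling`), whence `dχ ∧ dπ = 0`. The inequalities on `χ` and `χ'`
are `H₁` and `H₂` rewritten in these variables, and `χ ≠ π` is non-barotropy.

Converse. `Q² = -qQ` and `tr Q = -q ≠ 0` make `-Q/q` a projector of rank one, and positivity on
time-like vectors fixes the sign, so `Q = q u ⊗ u` with `u` obtained by normalizing `Q(dρ)`; the
Einstein equations then hold identically. Since `u(π) = (χ - π)u(ρ)/ρ ≠ 0`, the wedge condition
yields a smooth `X` with `χ = X(π)` locally (`exists_function_of`). The relations of the direct part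
become differential equations in `σ` for `π` and for the enthalpy index; solving them
(`exists_profile`) produces an ideal gas (`Profile.gas`), and reading them backwards gives `H₁` and
`H₂`. The entropy of the fluid is the function `s` for which `s/k + ln p` is the value of `σ`
belonging to `π`; then `u(s) = 0`, and conservation of energy turns into conservation of matter. -/

theorem _root_.ContDiffAt.differentiableAt_infty {E F : Type*} [NormedAddCommGroup E]
    [NormedSpace ℝ E] [NormedAddCommGroup F] [NormedSpace ℝ F] {f : E → F} {x : E}
    (hf : ContDiffAt ℝ ∞ f x) : DifferentiableAt ℝ f x :=
  hf.differentiableAt (by simp)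

theorem pd_congr {f g : E4 → ℝ} {x : E4} (h : f =ᶠ[𝓝 x] g) (i : Fin 4) : pd i f x = pd i g x := by
  unfold pd; rw [h.fderiv_eq]

theorem contDiffAt_pd {f : E4 → ℝ} {x : E4} (hf : ContDiffAt ℝ ∞ f x) (i : Fin 4) :
    ContDiffAt ℝ ∞ (pd i f) x :=
  (hf.fderiv_right (m := ∞) (by simp)).clm_apply contDiffAt_const

theorem pd_add {f g : E4 → ℝ} {x : E4} (hf : DifferentiableAt ℝ f x) (hg : DifferentiableAt ℝ g x)
    (i : Fin 4) : pd i (fun y => f y + g y) x = pd i f x + pd i g x := by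
  unfold pd; rw [fderiv_fun_add hf hg]; rfl

theorem pd_sub {f g : E4 → ℝ} {x : E4} (hf : DifferentiableAt ℝ f x) (hg : DifferentiableAt ℝ g x)
    (i : Fin 4) : pd i (fun y => f y - g y) x = pd i f x - pd i g x := by
  unfold pd; rw [fderiv_fun_sub hf hg]; rfl

theorem pd_mul {f g : E4 → ℝ} {x : E4} (hf : DifferentiableAt ℝ f x) (hg : DifferentiableAt ℝ g x)
    (i : Fin 4) : pd i (fun y => f y * g y) x = pd i f x * g x + f x * pd i g x := by
  unfold pd; rw [fderiv_fun_mul hf hg]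
  simp only [_root_.add_apply, _root_.smul_apply, smul_eq_mul]
  ring

theorem pd_const (c : ℝ) (x : E4) (i : Fin 4) : pd i (fun _ => c) x = 0 := by
  unfold pd; simp

theorem pd_const_mul {f : E4 → ℝ} {x : E4} (hf : DifferentiableAt ℝ f x) (c : ℝ) (i : Fin 4) :
    pd i (fun y => c * f y) x = c * pd i f x := by
  rw [pd_mul (differentiableAt_const c) hf, pd_const]; ring

theorem pd_sum {ι : Type*} {s : Finset ι} {f : ι → E4 → ℝ} {x : E4}
    (hf : ∀ a ∈ s, DifferentiableAt ℝ (f a) x) (i : Fin 4) :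
    pd i (fun y => ∑ a ∈ s, f a y) x = ∑ a ∈ s, pd i (f a) x := by
  unfold pd; rw [fderiv_fun_sum hf]; simp

theorem pd_comm {f : E4 → ℝ} {x : E4} (hf : ContDiffAt ℝ ∞ f x) (i j : Fin 4) :
    pd i (pd j f) x = pd j (pd i f) x := by
  have hd : DifferentiableAt ℝ (fderiv ℝ f) x :=
    (hf.fderiv_right (m := ∞) (by simp)).differentiableAt_infty
  have key : ∀ a b : Fin 4, pd a (pd b f) x =
      fderiv ℝ (fderiv ℝ f) x (EuclideanSpace.single a 1) (EuclideanSpace.single b 1) := by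
    intro a b
    change fderiv ℝ (fun y => fderiv ℝ f y (EuclideanSpace.single b 1)) x _ = _
    rw [fderiv_clm_apply hd (differentiableAt_const _)]
    simp
  rw [key, key, ((contDiffAt_infty.1 hf 2).isSymmSndFDerivAt (by simp)).eq]

/-! ### Directional derivatives -/

/-- The tangent vector of the coordinate space of given components. -/
def vec (v : Fin 4 → ℝ) : E4 := ∑ i, v i • EuclideanSpace.single i (1 : ℝ)

theorem sum_mul_pd (v : Fin 4 → ℝ) (f : E4 → ℝ) (x : E4) :
    ∑ i, v i * pd i f x = fderiv ℝ f x (vec v) := by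
  simp [vec, pd, map_sum]

theorem along_eq (u : E4 → Fin 4 → ℝ) (f : E4 → ℝ) (x : E4) :
    along u f x = fderiv ℝ f x (vec (u x)) := sum_mul_pd _ _ _

theorem along_congr {f g : E4 → ℝ} {x : E4} (h : f =ᶠ[𝓝 x] g) (u : E4 → Fin 4 → ℝ) :
    along u f x = along u g x := by
  rw [along_eq, along_eq, h.fderiv_eq]

/-! ### Matrix fields -/

/-- The field of partial derivatives of the entries of a matrix field. -/
def pdM (i : Fin 4) (A : Tensor2) (x : E4) : Matrix (Fin 4) (Fin 4) ℝ :=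
  Matrix.of fun a b => pd i (fun y => A y a b) x

/-- A matrix field whose entries are smooth at a point. -/
def SmoothM (A : Tensor2) (x : E4) : Prop := ∀ a b, ContDiffAt ℝ ∞ (fun y => A y a b) x

theorem SmoothM.diff {A : Tensor2} {x : E4} (h : SmoothM A x) (a b : Fin 4) :
    DifferentiableAt ℝ (fun y => A y a b) x := (h a b).differentiableAt_infty

theorem SmoothM.mul {A B : Tensor2} {x : E4} (hA : SmoothM A x) (hB : SmoothM B x) :
    SmoothM (fun y => A y * B y) x := fun a b => by
  simp only [Matrix.mul_apply]
  exact ContDiffAt.sum fun c _ => (hA a c).mul (hB c b)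

theorem SmoothM.add {A B : Tensor2} {x : E4} (hA : SmoothM A x) (hB : SmoothM B x) :
    SmoothM (fun y => A y + B y) x := fun a b => (hA a b).add (hB a b)

theorem SmoothM.sub {A B : Tensor2} {x : E4} (hA : SmoothM A x) (hB : SmoothM B x) :
    SmoothM (fun y => A y - B y) x := fun a b => (hA a b).sub (hB a b)

theorem SmoothM.smul {f : E4 → ℝ} {A : Tensor2} {x : E4} (hf : ContDiffAt ℝ ∞ f x)
    (hA : SmoothM A x) : SmoothM (fun y => f y • A y) x := fun a b => hf.mul (hA a b)

theorem SmoothM.transpose {A : Tensor2} {x : E4} (hA : SmoothM A x) :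
    SmoothM (fun y => (A y)ᵀ) x := fun a b => hA b a

theorem SmoothM.pdM {A : Tensor2} {x : E4} (hA : SmoothM A x) (i : Fin 4) :
    SmoothM (pdM i A) x := fun a b => contDiffAt_pd (hA a b) i

theorem SmoothM.trace {A : Tensor2} {x : E4} (hA : SmoothM A x) :
    ContDiffAt ℝ ∞ (fun y => (A y).trace) x :=
  ContDiffAt.sum fun a _ => hA a a

theorem SmoothM.det {A : Tensor2} {x : E4} (hA : SmoothM A x) :
    ContDiffAt ℝ ∞ (fun y => (A y).det) x := by
  simp only [Matrix.det_apply']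
  exact ContDiffAt.sum fun σ _ => contDiffAt_const.mul (contDiffAt_prod fun i _ => hA _ _)

theorem SmoothM.inv {A : Tensor2} {x : E4} (hA : SmoothM A x) (h : IsUnit (A x).det) :
    SmoothM (fun y => (A y)⁻¹) x := fun a b => by
  simp only [Matrix.inv_def, Matrix.smul_apply, Ring.inverse_eq_inv', smul_eq_mul,
    Matrix.adjugate_apply]
  refine (hA.det.inv h.ne_zero).mul (SmoothM.det fun i j => ?_)
  by_cases hib : i = b
  · subst hib; simp only [Matrix.updateRow_self]; exact contDiffAt_const
  · simp only [Matrix.updateRow_ne hib]; exact hA i j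

theorem pdM_congr {A B : Tensor2} {x : E4} (h : A =ᶠ[𝓝 x] B) (i : Fin 4) :
    pdM i A x = pdM i B x := by
  ext a b
  refine pd_congr ?_ i
  filter_upwards [h] with y hy; rw [hy]

theorem pdM_add {A B : Tensor2} {x : E4} (hA : SmoothM A x) (hB : SmoothM B x) (i : Fin 4) :
    pdM i (fun y => A y + B y) x = pdM i A x + pdM i B x := by
  ext a b; exact pd_add (hA.diff a b) (hB.diff a b) i

theorem pdM_sub {A B : Tensor2} {x : E4} (hA : SmoothM A x) (hB : SmoothM B x) (i : Fin 4) :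
    pdM i (fun y => A y - B y) x = pdM i A x - pdM i B x := by
  ext a b; exact pd_sub (hA.diff a b) (hB.diff a b) i

theorem pdM_mul {A B : Tensor2} {x : E4} (hA : SmoothM A x) (hB : SmoothM B x) (i : Fin 4) :
    pdM i (fun y => A y * B y) x = pdM i A x * B x + A x * pdM i B x := by
  ext a b
  have h : pd i (fun y => ∑ c, A y a c * B y c b) x = ∑ c, pd i (fun y => A y a c * B y c b) x :=
    pd_sum (fun c _ => (hA.diff a c).mul (hB.diff c b)) i
  simp only [pdM, Matrix.mul_apply, Matrix.of_apply, Matrix.add_apply]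
  rw [h, ← Finset.sum_add_distrib]
  exact Finset.sum_congr rfl fun c _ => pd_mul (hA.diff a c) (hB.diff c b) i

theorem pdM_transpose (A : Tensor2) (x : E4) (i : Fin 4) :
    pdM i (fun y => (A y)ᵀ) x = (pdM i A x)ᵀ := rfl

theorem pdM_comm {A : Tensor2} {x : E4} (hA : SmoothM A x) (i j : Fin 4) :
    pdM i (pdM j A) x = pdM j (pdM i A) x := by
  ext a b; exact pd_comm (hA a b) i j

theorem pdM_const (A : Matrix (Fin 4) (Fin 4) ℝ) (x : E4) (i : Fin 4) :
    pdM i (fun _ => A) x = 0 := by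
  ext a b; exact pd_const _ _ _

/-! ### Lorentzian metrics in a coordinate domain -/

/-- The components of a smooth Lorentzian metric on an open domain of the coordinate space. -/
structure IsLorentzOn (g : Tensor2) (Ω : Set E4) : Prop where
  isOpen : IsOpen Ω
  smooth : ∀ x ∈ Ω, SmoothM g x
  lorentz : ∀ x ∈ Ω, ∃ P : Matrix (Fin 4) (Fin 4) ℝ, IsUnit P.det ∧
    g x = Pᵀ * Matrix.diagonal ![-1, 1, 1, 1] * P

namespace IsLorentzOn

variable {g : Tensor2} {Ω : Set E4} (hg : IsLorentzOn g Ω) {x : E4} (hx : x ∈ Ω)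
include hg hx

theorem mem_nhds : Ω ∈ 𝓝 x := hg.isOpen.mem_nhds hx

theorem det : IsUnit (g x).det := by
  obtain ⟨P, hP, h⟩ := hg.lorentz x hx
  rw [h, Matrix.det_mul, Matrix.det_mul, Matrix.det_transpose]
  refine (hP.mul ?_).mul hP
  simp [Matrix.det_diagonal, Fin.prod_univ_four]

theorem symm : (g x)ᵀ = g x := by
  obtain ⟨P, hP, h⟩ := hg.lorentz x hx
  rw [h]; simp [Matrix.transpose_mul, Matrix.mul_assoc]

theorem symm_apply (a b : Fin 4) : g x a b = g x b a := by
  conv_lhs => rw [← hg.symm hx]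
  rfl

theorem inv_symm : ((g x)⁻¹)ᵀ = (g x)⁻¹ := by
  rw [Matrix.transpose_nonsing_inv, hg.symm hx]

theorem mul_inv : g x * (g x)⁻¹ = 1 := Matrix.mul_nonsing_inv _ (hg.det hx)

theorem inv_mul : (g x)⁻¹ * g x = 1 := Matrix.nonsing_inv_mul _ (hg.det hx)

theorem smooth_inv : SmoothM (fun y => (g y)⁻¹) x := (hg.smooth x hx).inv (hg.det hx)

theorem smooth_christoffel (l i j : Fin 4) : ContDiffAt ℝ ∞ (christoffel g l i j) x := by
  unfold christoffel
  refine contDiffAt_const.mul (ContDiffAt.sum fun m _ => (hg.smooth_inv hx l m).mul ?_)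
  exact ((contDiffAt_pd (hg.smooth x hx m j) i).add (contDiffAt_pd (hg.smooth x hx m i) j)).sub
    (contDiffAt_pd (hg.smooth x hx i j) m)

end IsLorentzOn

/-! ### Curvature and the contracted Bianchi identity -/

/-- The matrices `(Γᵃ_{cb})_{ab}` of the connection. -/
def conn (g : Tensor2) (c : Fin 4) : Tensor2 :=
  fun y => Matrix.of fun a b => christoffel g a c b y

/-- The matrices `(Rᵃ_{bcd})_{ab}` of the curvature. -/
def curv (g : Tensor2) (c d : Fin 4) : Tensor2 := fun y =>
  pdM c (conn g d) y - pdM d (conn g c) y + (conn g c y * conn g d y - conn g d y * conn g c y)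

/-- The curvature `R^{ab}_{cd}` with two indices raised. -/
def curvUp (g : Tensor2) (c d : Fin 4) : Tensor2 := fun y => curv g c d y * (g y)⁻¹

/-- The Ricci tensor `Rᵃ_b`, as an endomorphism. -/
def ricciUp (g : Tensor2) : Tensor2 := fun y => (g y)⁻¹ * ricci g y

namespace IsLorentzOn

variable {g : Tensor2} {Ω : Set E4} (hg : IsLorentzOn g Ω) {x : E4} (hx : x ∈ Ω)
include hg hx

theorem eventually_of_forall {p : E4 → Prop} (h : ∀ y ∈ Ω, p y) : ∀ᶠ y in 𝓝 x, p y :=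
  Filter.mem_of_superset (hg.mem_nhds hx) h

theorem pd_metric_symm (c a b : Fin 4) :
    pd c (fun y => g y a b) x = pd c (fun y => g y b a) x :=
  pd_congr (hg.eventually_of_forall hx fun _ hy => hg.symm_apply hy a b) c

theorem christoffel_symm (l i j : Fin 4) : christoffel g l i j x = christoffel g l j i x := by
  unfold christoffel
  congr 1
  refine Finset.sum_congr rfl fun m _ => ?_
  rw [hg.pd_metric_symm hx m i j]; ring

theorem smooth_conn (c : Fin 4) : SmoothM (conn g c) x :=
  fun a b => hg.smooth_christoffel hx a c b

/-- Metric compatibility in matrix form. `K` holds the Christoffel symbols with lowered first index;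
in `K + Kᵀ` the terms antisymmetric in that index and the last one cancel, leaving the derivative of
the metric. -/
theorem pdM_metric (c : Fin 4) :
    pdM c g x = (conn g c x)ᵀ * g x + g x * conn g c x := by
  set K : Matrix (Fin 4) (Fin 4) ℝ := Matrix.of fun m b => (1 / 2) *
    (pd c (fun y => g y m b) x + pd b (fun y => g y m c) x - pd m (fun y => g y c b) x) with hK
  have h1 : conn g c x = (g x)⁻¹ * K := by
    ext a b
    simp only [conn, christoffel, hK, Matrix.mul_apply, Matrix.of_apply, Finset.mul_sum]
    exact Finset.sum_congr rfl fun m _ => by ring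
  have h2 : g x * conn g c x = K := by
    rw [h1, ← Matrix.mul_assoc, hg.mul_inv hx, Matrix.one_mul]
  have h3 : (conn g c x)ᵀ * g x = Kᵀ := by
    rw [← h2, Matrix.transpose_mul, hg.symm hx]
  rw [h2, h3]
  ext a b
  simp only [hK, pdM, Matrix.add_apply, Matrix.transpose_apply, Matrix.of_apply]
  rw [hg.pd_metric_symm hx c b a, hg.pd_metric_symm hx a b c, hg.pd_metric_symm hx b c a]
  ring

theorem pdM_inv (c : Fin 4) :
    pdM c (fun y => (g y)⁻¹) x = -((g x)⁻¹ * (conn g c x)ᵀ + conn g c x * (g x)⁻¹) := by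
  have h : pdM c (fun y => (g y)⁻¹ * g y) x = 0 := by
    rw [← pdM_const 1 x c]
    exact pdM_congr (hg.eventually_of_forall hx fun y hy => hg.inv_mul hy) c
  rw [pdM_mul (hg.smooth_inv hx) (hg.smooth x hx), hg.pdM_metric hx] at h
  have h' := congrArg (· * (g x)⁻¹) h
  simp only [Matrix.add_mul, Matrix.mul_add, Matrix.mul_assoc, hg.mul_inv hx, Matrix.mul_one,
    Matrix.zero_mul] at h'
  rw [← Matrix.mul_assoc (g x)⁻¹ (g x), hg.inv_mul hx, Matrix.one_mul] at h'
  exact eq_neg_of_add_eq_zero_left h'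

theorem smooth_curv (c d : Fin 4) : SmoothM (curv g c d) x :=
  (((hg.smooth_conn hx d).pdM c).sub ((hg.smooth_conn hx c).pdM d)).add
    (((hg.smooth_conn hx c).mul (hg.smooth_conn hx d)).sub
      ((hg.smooth_conn hx d).mul (hg.smooth_conn hx c)))

theorem smooth_curvUp (c d : Fin 4) : SmoothM (curvUp g c d) x :=
  (hg.smooth_curv hx c d).mul (hg.smooth_inv hx)

theorem pdM_pdM_metric (c d : Fin 4) : pdM d (pdM c g) x =
    (pdM d (conn g c) x)ᵀ * g x +
      (conn g c x)ᵀ * ((conn g d x)ᵀ * g x + g x * conn g d x) +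
      (((conn g d x)ᵀ * g x + g x * conn g d x) * conn g c x + g x * pdM d (conn g c) x) := by
  have hc := hg.smooth_conn hx c
  have hgx := hg.smooth x hx
  rw [pdM_congr (hg.eventually_of_forall hx fun y hy => hg.pdM_metric hy c) d,
    pdM_add (hc.transpose.mul hgx) (hgx.mul hc), pdM_mul hc.transpose hgx, pdM_mul hgx hc,
    pdM_transpose, hg.pdM_metric hx]

/-- Integrability of metric compatibility: second derivatives of `g` commute, and once they are
expressed through the connection their difference is exactly this combination. -/
theorem curv_antisymm (c d : Fin 4) : g x * curv g c d x + (curv g c d x)ᵀ * g x = 0 := by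
  have h := pdM_comm (hg.smooth x hx) c d
  rw [hg.pdM_pdM_metric hx, hg.pdM_pdM_metric hx, ← sub_eq_zero] at h
  rw [← h]
  simp only [curv, Matrix.transpose_add, Matrix.transpose_sub, Matrix.transpose_mul]
  noncomm_ring

theorem curvUp_transpose (c d : Fin 4) : (curvUp g c d x)ᵀ = -curvUp g c d x := by
  have h := congrArg (fun A => (g x)⁻¹ * A * (g x)⁻¹) (hg.curv_antisymm hx c d)
  simp only [Matrix.mul_add, Matrix.add_mul, Matrix.mul_zero, Matrix.zero_mul] at h
  rw [← Matrix.mul_assoc, hg.inv_mul hx, Matrix.one_mul, Matrix.mul_assoc, Matrix.mul_assoc,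
    hg.mul_inv hx, Matrix.mul_one] at h
  rw [curvUp, Matrix.transpose_mul, hg.inv_symm hx]
  exact eq_neg_of_add_eq_zero_right h

theorem curvUp_apply_symm (c d a b : Fin 4) : curvUp g c d x a b = -curvUp g c d x b a := by
  have h := congrFun (congrFun (hg.curvUp_transpose hx c d) b) a
  simpa using h

omit hg hx in
theorem curv_swap (c d : Fin 4) (x : E4) : curv g d c x = -curv g c d x := by
  simp only [curv]; abel

omit hg hx in
theorem curvUp_swap (c d : Fin 4) (x : E4) : curvUp g d c x = -curvUp g c d x := by
  rw [curvUp, curv_swap, Matrix.neg_mul, curvUp]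

theorem trace_curv (c d : Fin 4) : (curv g c d x).trace = 0 := by
  have h : curv g c d x = -((g x)⁻¹ * ((curv g c d x)ᵀ * g x)) := by
    have := congrArg (fun A => (g x)⁻¹ * A) (hg.curv_antisymm hx c d)
    simp only [Matrix.mul_add, Matrix.mul_zero] at this
    rw [← Matrix.mul_assoc, hg.inv_mul hx, Matrix.one_mul] at this
    exact eq_neg_of_add_eq_zero_left this
  have h2 := congrArg Matrix.trace h
  rw [Matrix.trace_neg, Matrix.trace_mul_comm, Matrix.mul_assoc, hg.mul_inv hx, Matrix.mul_one,
    Matrix.trace_transpose] at h2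
  linarith

/-- The second Bianchi identity. -/
theorem bianchi (e c d : Fin 4) :
    (pdM e (curv g c d) x + (conn g e x * curv g c d x - curv g c d x * conn g e x)) +
    (pdM c (curv g d e) x + (conn g c x * curv g d e x - curv g d e x * conn g c x)) +
    (pdM d (curv g e c) x + (conn g d x * curv g e c x - curv g e c x * conn g d x)) = 0 := by
  have key : ∀ e c d, pdM e (curv g c d) x =
      pdM e (pdM c (conn g d)) x - pdM e (pdM d (conn g c)) x +
      ((pdM e (conn g c) x * conn g d x + conn g c x * pdM e (conn g d) x) -
       (pdM e (conn g d) x * conn g c x + conn g d x * pdM e (conn g c) x)) := by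
    intro e c d
    have hc := hg.smooth_conn hx c
    have hd := hg.smooth_conn hx d
    unfold curv
    rw [pdM_add ((hd.pdM c).sub (hc.pdM d)) ((hc.mul hd).sub (hd.mul hc)),
      pdM_sub (hd.pdM c) (hc.pdM d), pdM_sub (hc.mul hd) (hd.mul hc), pdM_mul hc hd,
      pdM_mul hd hc]
  -- With the second derivatives of the connection in a common order, the identity is formal in
  -- noncommuting matrices; its cubic terms cancel by the Jacobi identity.
  rw [key, key, key, pdM_comm (hg.smooth_conn hx d) e c, pdM_comm (hg.smooth_conn hx c) e d,
    pdM_comm (hg.smooth_conn hx e) c d]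
  simp only [curv]
  noncomm_ring

/-- The inverse metric is covariantly constant, so raising an index commutes with the covariant
derivative. With two upper indices antisymmetric, the contraction of the identity needs no further
use of the metric. -/
theorem bianchi_curvUp (e c d : Fin 4) :
    (pdM e (curvUp g c d) x + conn g e x * curvUp g c d x + curvUp g c d x * (conn g e x)ᵀ) +
    (pdM c (curvUp g d e) x + conn g c x * curvUp g d e x + curvUp g d e x * (conn g c x)ᵀ) +
    (pdM d (curvUp g e c) x + conn g d x * curvUp g e c x + curvUp g e c x * (conn g d x)ᵀ) = 0 := by
  have key : ∀ e c d, pdM e (curvUp g c d) x + conn g e x * curvUp g c d x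
      + curvUp g c d x * (conn g e x)ᵀ =
      (pdM e (curv g c d) x + (conn g e x * curv g c d x - curv g c d x * conn g e x)) *
        (g x)⁻¹ := by
    intro e c d
    have : pdM e (curvUp g c d) x = pdM e (curv g c d) x * (g x)⁻¹ +
        curv g c d x * pdM e (fun y => (g y)⁻¹) x :=
      pdM_mul (hg.smooth_curv hx c d) (hg.smooth_inv hx) e
    rw [this, hg.pdM_inv hx]
    simp only [curvUp]
    noncomm_ring
  rw [key, key, key, ← Matrix.add_mul, ← Matrix.add_mul, hg.bianchi hx, Matrix.zero_mul]

theorem ricci_eq (i j : Fin 4) : ricci g x i j = ∑ l, curv g l j x l i := by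
  have h : ∀ l m, pd m (christoffel g l i j) x = pd m (christoffel g l j i) x := fun l m =>
    pd_congr (hg.eventually_of_forall hx fun y hy => hg.christoffel_symm hy l i j) m
  have h' : ∀ l, pd j (christoffel g l i l) x = pd j (christoffel g l l i) x := fun l =>
    pd_congr (hg.eventually_of_forall hx fun y hy => hg.christoffel_symm hy l i l) j
  simp only [ricci, curv, conn, pdM, Matrix.of_apply, Matrix.add_apply, Matrix.sub_apply,
    Matrix.mul_apply, Finset.sum_add_distrib, Finset.sum_sub_distrib, h, h']
  have e1 : ∀ m, christoffel g m i j x = christoffel g m j i x :=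
    fun m => hg.christoffel_symm hx m i j
  have e2 : ∀ m l, christoffel g m i l x = christoffel g m l i x :=
    fun m l => hg.christoffel_symm hx m i l
  simp only [e1, e2]
  ring

theorem smooth_ricci : SmoothM (ricci g) x := by
  intro i j
  have : ContDiffAt ℝ ∞ (fun y => ∑ l, curv g l j y l i) x :=
    ContDiffAt.sum fun l _ => hg.smooth_curv hx l j l i
  exact this.congr_of_eventuallyEq (hg.eventually_of_forall hx fun y hy => hg.ricci_eq hy i j)

/-- The first Bianchi identity. -/
theorem first_bianchi (a b c d : Fin 4) :
    curv g c d x a b + curv g d b x a c + curv g b c x a d = 0 := by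
  have h : ∀ e i j, pd e (christoffel g a i j) x = pd e (christoffel g a j i) x := fun e i j =>
    pd_congr (hg.eventually_of_forall hx fun y hy => hg.christoffel_symm hy a i j) e
  simp only [curv, conn, pdM, Matrix.of_apply, Matrix.add_apply, Matrix.sub_apply,
    Matrix.mul_apply]
  rw [h c d b, h d b c, h b c d]
  simp only [hg.christoffel_symm hx _ d b, hg.christoffel_symm hx _ c b,
    hg.christoffel_symm hx _ d c]
  ring

/-- By the first Bianchi identity the antisymmetric part of the Ricci tensor is the trace of the
curvature matrix, which vanishes because that matrix is `g`-antisymmetric. -/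
theorem ricci_symm : (ricci g x)ᵀ = ricci g x := by
  ext i j
  rw [Matrix.transpose_apply, hg.ricci_eq hx, hg.ricci_eq hx, ← sub_eq_zero,
    ← Finset.sum_sub_distrib]
  have : ∑ l, (curv g l i x l j - curv g l j x l i) = (curv g j i x).trace := by
    refine Finset.sum_congr rfl fun l _ => ?_
    have h := hg.first_bianchi hx l i l j
    have h2 := congrFun (congrFun (curv_swap (g := g) l i x) l) j
    simp only [Matrix.neg_apply] at h2
    simp only [Matrix.diag_apply]
    linarith
  rw [this, hg.trace_curv hx]

theorem ricciUp_eq (b d : Fin 4) : ricciUp g x b d = ∑ a, curvUp g a d x a b := by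
  have hs : ∀ m, (g x)⁻¹ b m = (g x)⁻¹ m b := fun m => by
    conv_lhs => rw [← hg.inv_symm hx]
    rfl
  simp only [ricciUp, curvUp, Matrix.mul_apply, hg.ricci_eq hx, hs, Finset.mul_sum]
  rw [Finset.sum_comm]
  exact Finset.sum_congr rfl fun _ _ => Finset.sum_congr rfl fun _ _ => mul_comm _ _

omit hg hx in
theorem tS_eq (x : E4) : tS g x = ∑ b, ricciUp g x b b := rfl

theorem smooth_ricciUp : SmoothM (ricciUp g) x := (hg.smooth_inv hx).mul (hg.smooth_ricci hx)

theorem smooth_tS : ContDiffAt ℝ ∞ (tS g) x := (hg.smooth_ricciUp hx).trace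

/-- The contracted Bianchi identity. -/
theorem contracted_bianchi (e : Fin 4) :
    2 * ((∑ a, pd a (fun y => ricciUp g y a e) x) +
      (∑ a, ∑ m, christoffel g a a m x * ricciUp g x m e) -
      ∑ a, ∑ m, christoffel g m a e x * ricciUp g x a m) = pd e (tS g) x := by
  have hU : ∀ c d a b, DifferentiableAt ℝ (fun y => curvUp g c d y a b) x :=
    fun c d a b => (hg.smooth_curvUp hx c d).diff a b
  have anti : ∀ c d a b, curvUp g c d x a b = -curvUp g c d x b a :=
    fun c d a b => hg.curvUp_apply_symm hx c d a b
  have swap : ∀ c d a b, curvUp g d c x a b = -curvUp g c d x a b := fun c d a b => by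
    rw [curvUp_swap]; rfl
  have ric : ∀ b d, ∑ a, curvUp g a d x a b = ricciUp g x b d := fun b d =>
    (hg.ricciUp_eq hx b d).symm
  have pdric : ∀ f b d, ∑ a, pd f (fun y => curvUp g a d y a b) x =
      pd f (fun y => ricciUp g y b d) x := fun f b d => by
    rw [← pd_sum fun a _ => hU a d a b]
    exact (pd_congr (hg.eventually_of_forall hx fun y hy => hg.ricciUp_eq hy b d) f).symm
  have sym : ∀ a b c, christoffel g a b c x = christoffel g a c b x :=
    fun a b c => hg.christoffel_symm hx a b c
  have pdanti : ∀ f c d a b, pd f (fun y => curvUp g c d y a b) x =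
      -pd f (fun y => curvUp g c d y b a) x := fun f c d a b => by
    rw [← neg_one_mul, ← pd_const_mul (hU c d b a)]
    exact pd_congr (hg.eventually_of_forall hx fun y hy => by
      rw [hg.curvUp_apply_symm hy]; ring) f
  have pdswap : ∀ f c d a b, pd f (fun y => curvUp g d c y a b) x =
      -pd f (fun y => curvUp g c d y a b) x := fun f c d a b => by
    rw [← neg_one_mul, ← pd_const_mul (hU c d a b)]
    exact congrArg (fun F => pd f F x) (funext fun y => by
      rw [curvUp_swap c d, Matrix.neg_apply]; ring)
  -- The second Bianchi identity traced over both upper indices. Of the nine sums, `t1` is the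
  -- gradient of the scalar curvature, `t4` and `t7` are each minus the coordinate divergence of
  -- Ricci, `t2`, `t3`, `t5`, `t9` are its connection terms, each occurring twice, and `t6`, `t8`
  -- pair antisymmetric with symmetric indices.
  have h0 : ∑ a, ∑ b, (((pd e (fun y => curvUp g a b y a b) x
      + ∑ m, christoffel g a e m x * curvUp g a b x m b)
      + ∑ m, curvUp g a b x a m * christoffel g b e m x) +
      ((pd a (fun y => curvUp g b e y a b) x + ∑ m, christoffel g a a m x * curvUp g b e x m b)
      + ∑ m, curvUp g b e x a m * christoffel g b a m x) +
      ((pd b (fun y => curvUp g e a y a b) x + ∑ m, christoffel g a b m x * curvUp g e a x m b)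
      + ∑ m, curvUp g e a x a m * christoffel g b b m x)) = 0 :=
    Finset.sum_eq_zero fun a _ => Finset.sum_eq_zero fun b _ => by
      have h := congrFun (congrFun (hg.bianchi_curvUp hx e a b) a) b
      simpa only [Matrix.add_apply, Matrix.mul_apply, pdM, conn, Matrix.of_apply,
        Matrix.transpose_apply, Matrix.zero_apply] using h
  have t1 : ∑ a, ∑ b, pd e (fun y => curvUp g a b y a b) x = pd e (tS g) x := by
    have : tS g =ᶠ[𝓝 x] fun y => ∑ b, ∑ a, curvUp g a b y a b :=
      hg.eventually_of_forall hx fun y hy => by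
        rw [tS_eq]; exact Finset.sum_congr rfl fun b _ => hg.ricciUp_eq hy b b
    rw [pd_congr this, pd_sum fun b _ => DifferentiableAt.fun_sum fun a _ => hU a b a b,
      Finset.sum_comm]
    exact Finset.sum_congr rfl fun b _ => (pd_sum (fun a _ => hU a b a b) e).symm
  have t2 : ∑ a, ∑ b, ∑ m, christoffel g a e m x * curvUp g a b x m b =
      ∑ a, ∑ m, christoffel g m a e x * ricciUp g x a m := by
    rw [Finset.sum_comm (f := fun a m => christoffel g m a e x * ricciUp g x a m)]
    refine Finset.sum_congr rfl fun a _ => ?_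
    rw [Finset.sum_comm]
    refine Finset.sum_congr rfl fun m _ => ?_
    rw [← Finset.mul_sum, ← ric m a, sym]
    refine congrArg (HMul.hMul _) ?_
    exact Finset.sum_congr rfl fun b _ => by rw [anti, swap b a, neg_neg]
  have t3 : ∑ a, ∑ b, ∑ m, curvUp g a b x a m * christoffel g b e m x =
      ∑ a, ∑ m, christoffel g m a e x * ricciUp g x a m := by
    rw [Finset.sum_comm (f := fun a m => christoffel g m a e x * ricciUp g x a m),
      Finset.sum_comm]
    refine Finset.sum_congr rfl fun b _ => ?_
    rw [Finset.sum_comm]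
    refine Finset.sum_congr rfl fun m _ => ?_
    rw [← Finset.sum_mul, ric, sym, mul_comm]
  have t4 : ∑ a, ∑ b, pd a (fun y => curvUp g b e y a b) x =
      -∑ a, pd a (fun y => ricciUp g y a e) x := by
    rw [← Finset.sum_neg_distrib]
    refine Finset.sum_congr rfl fun a _ => ?_
    rw [← pdric, ← Finset.sum_neg_distrib]
    exact Finset.sum_congr rfl fun b _ => pdanti _ _ _ _ _
  have t5 : ∑ a, ∑ b, ∑ m, christoffel g a a m x * curvUp g b e x m b =
      -∑ a, ∑ m, christoffel g a a m x * ricciUp g x m e := by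
    rw [← Finset.sum_neg_distrib]
    refine Finset.sum_congr rfl fun a _ => ?_
    rw [Finset.sum_comm, ← Finset.sum_neg_distrib]
    refine Finset.sum_congr rfl fun m _ => ?_
    rw [← Finset.mul_sum, ← ric, ← mul_neg, ← Finset.sum_neg_distrib]
    refine congrArg (HMul.hMul _) ?_
    exact Finset.sum_congr rfl fun b _ => anti _ _ _ _
  have cancel : ∀ (K C : Fin 4 → Fin 4 → ℝ), (∀ a b, K a b = -K b a) →
      (∀ a b, C a b = C b a) → ∑ a, ∑ m, K a m * C a m = 0 := fun K C hK hC => by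
    have h : ∑ a, ∑ m, K a m * C a m = -∑ a, ∑ m, K a m * C a m := by
      conv_lhs => rw [Finset.sum_comm]
      simp only [← Finset.sum_neg_distrib]
      refine Finset.sum_congr rfl fun a _ => Finset.sum_congr rfl fun m _ => ?_
      rw [hK m a, hC m a]; ring
    linarith
  have t6 : ∑ a, ∑ b, ∑ m, curvUp g b e x a m * christoffel g b a m x = 0 := by
    rw [Finset.sum_comm]
    exact Finset.sum_eq_zero fun b _ =>
      cancel (fun a m => curvUp g b e x a m) _ (fun _ _ => anti _ _ _ _) fun _ _ => sym _ _ _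
  have t7 : ∑ a, ∑ b, pd b (fun y => curvUp g e a y a b) x =
      -∑ a, pd a (fun y => ricciUp g y a e) x := by
    rw [← Finset.sum_neg_distrib, Finset.sum_comm]
    refine Finset.sum_congr rfl fun a _ => ?_
    rw [← pdric, ← Finset.sum_neg_distrib]
    exact Finset.sum_congr rfl fun b _ => pdswap _ _ _ _ _
  have t8 : ∑ a, ∑ b, ∑ m, christoffel g a b m x * curvUp g e a x m b = 0 :=
    Finset.sum_eq_zero fun a _ => by
      simp only [mul_comm (christoffel g a _ _ x)]
      rw [Finset.sum_comm]
      exact cancel (fun m b => curvUp g e a x m b) (fun m b => christoffel g a b m x)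
        (fun _ _ => anti _ _ _ _) fun _ _ => sym _ _ _
  have t9 : ∑ a, ∑ b, ∑ m, curvUp g e a x a m * christoffel g b b m x =
      -∑ a, ∑ m, christoffel g a a m x * ricciUp g x m e := by
    rw [Finset.sum_comm, ← Finset.sum_neg_distrib]
    refine Finset.sum_congr rfl fun b _ => ?_
    rw [Finset.sum_comm, ← Finset.sum_neg_distrib]
    refine Finset.sum_congr rfl fun m _ => ?_
    rw [← Finset.sum_mul, ← ric, mul_comm, ← mul_neg, ← Finset.sum_neg_distrib]
    refine congrArg (HMul.hMul _) ?_
    exact Finset.sum_congr rfl fun a _ => swap _ _ _ _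
  simp only [Finset.sum_add_distrib] at h0
  rw [t1, t2, t3, t4, t5, t6, t7, t8, t9] at h0
  linarith

end IsLorentzOn

/-! ### Algebra of perfect fluid Ricci tensors -/

theorem bil_eq (S : Matrix (Fin 4) (Fin 4) ℝ) (v w : Fin 4 → ℝ) : bil S v w = v ⬝ᵥ S *ᵥ w := by
  simp only [bil, dotProduct, Matrix.mulVec, Finset.mul_sum]
  exact Finset.sum_congr rfl fun i _ => Finset.sum_congr rfl fun j _ => by ring

theorem raise_eq (g : Tensor2) (x : E4) (α : Fin 4 → ℝ) : raise g x α = (g x)⁻¹ *ᵥ α := rfl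

theorem cbrt_cube (a : ℝ) : cbrt (a ^ 3) = a :=
  (Odd.strictMono_pow (by decide : Odd 3)).injective (cbrt_pow_three _)

theorem bil_vecMulVec (c : ℝ) (a v w : Fin 4 → ℝ) :
    bil (c • vecMulVec a a) v w = c * (v ⬝ᵥ a) * (w ⬝ᵥ a) := by
  rw [bil_eq, Matrix.smul_mulVec, Matrix.vecMulVec_mulVec, dotProduct_smul, op_smul_eq_smul,
    dotProduct_smul, dotProduct_comm a w]
  simp only [smul_eq_mul]; ring

/-- As an endomorphism, `N` is `(ρ + p)(W + ¼)` with `W² = -W` and `tr W = -1`. Its eigenvalues are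
`-¾(ρ + p)` once and `¼(ρ + p)` three times, so `⅓ tr N³ = -(ρ + p)³/8`, and the normalization `-2∛`
returns `ρ + p`. -/
theorem concomitants_of_einstein {g : Tensor2} {x : E4} (hdet : IsUnit (g x).det)
    {u : Fin 4 → ℝ} {ρ p : ℝ} (hu : bil (g x) u u = -1)
    (hE : ricci g x - (tS g x / 2) • g x =
      (ρ + p) • vecMulVec (g x *ᵥ u) (g x *ᵥ u) + p • g x) :
    tS g x = ρ - 3 * p ∧ qS g x = ρ + p ∧
      tQ g x = (ρ + p) • vecMulVec (g x *ᵥ u) (g x *ᵥ u) := by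
  rw [bil_eq] at hu
  set w := g x *ᵥ u with hw
  have hinv : (g x)⁻¹ * g x = 1 := Matrix.nonsing_inv_mul _ hdet
  have hW : (g x)⁻¹ * vecMulVec w w = vecMulVec u w := by
    rw [Matrix.mul_vecMulVec, hw, Matrix.mulVec_mulVec, hinv, Matrix.one_mulVec]
  have htr : (vecMulVec u w).trace = -1 := by rw [Matrix.trace_vecMulVec, hu]
  have hsq : vecMulVec u w * vecMulVec u w = -vecMulVec u w := by
    rw [Matrix.vecMulVec_mul_vecMulVec, dotProduct_comm w u, hu]
    ext i j; simp [vecMulVec_apply]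
  have ht : tS g x = ρ - 3 * p := by
    have h := congrArg (fun A => ((g x)⁻¹ * A).trace) hE
    simp only [Matrix.mul_sub, Matrix.mul_add, Matrix.mul_smul, hinv, hW, Matrix.trace_sub,
      Matrix.trace_add, Matrix.trace_smul, htr, Matrix.trace_one, smul_eq_mul] at h
    rw [← tS] at h
    simp at h
    linarith
  have hN : tN g x = (ρ + p) • vecMulVec w w + ((ρ + p) / 4) • g x := by
    have : ricci g x = (ρ + p) • vecMulVec w w + p • g x + (tS g x / 2) • g x := by
      rw [← hE]; abel
    rw [tN, this, ht]
    module
  have hq : qS g x = ρ + p := by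
    have e1 : (g x)⁻¹ * tN g x = (ρ + p) • (vecMulVec u w + (1 / 4 : ℝ) • 1) := by
      rw [hN, Matrix.mul_add, Matrix.mul_smul, Matrix.mul_smul, hW, hinv]
      module
    set W := vecMulVec u w
    have e2 : (W + (1 / 4 : ℝ) • (1 : Matrix (Fin 4) (Fin 4) ℝ)) ^ 3 =
        (7 / 16 : ℝ) • W + (1 / 64 : ℝ) • 1 := by
      simp only [pow_succ, pow_zero, Matrix.one_mul, Matrix.add_mul, Matrix.mul_add, hsq,
        Matrix.smul_mul, Matrix.mul_smul, Matrix.mul_one, Matrix.neg_mul]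
      module
    have e3 : (((g x)⁻¹ * tN g x) ^ 3).trace / 3 = (-((ρ + p) / 2)) ^ 3 := by
      rw [e1, smul_pow, e2, Matrix.trace_smul, Matrix.trace_add, Matrix.trace_smul,
        Matrix.trace_smul, htr, Matrix.trace_one]
      simp only [smul_eq_mul, Fintype.card_fin]
      push_cast
      ring
    rw [qS, e3, cbrt_cube]; ring
  refine ⟨ht, hq, ?_⟩
  rw [tQ, hN, hq]; module

/-- A tensor `Q = wᵢwⱼ / Q(z,z)`, where `w = Q(z)`, from the algebraic Rainich condition. -/
theorem eq_vecMulVec_of_projector {G Q : Matrix (Fin 4) (Fin 4) ℝ} {q : ℝ} (hG : IsUnit G.det)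
    (hQ : Qᵀ = Q) (hq : q ≠ 0) (htr : (G⁻¹ * Q).trace = -q)
    (halg : Q * G⁻¹ * Q + q • Q = 0) {z : Fin 4 → ℝ} (hz : z ⬝ᵥ Q *ᵥ z ≠ 0) :
    Q = (z ⬝ᵥ Q *ᵥ z)⁻¹ • vecMulVec (Q *ᵥ z) (Q *ᵥ z) := by
  set m := z ⬝ᵥ Q *ᵥ z with hm
  set w := Q *ᵥ z with hw
  have hQQ : Q * G⁻¹ * Q = -(q • Q) := eq_neg_of_add_eq_zero_left halg
  have hzQ : z ᵥ* Q = w := by rw [hw, ← hQ, Matrix.vecMul_transpose, hQ]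
  have hQw : Q *ᵥ (G⁻¹ *ᵥ w) = -(q • w) := by
    rw [hw, Matrix.mulVec_mulVec, Matrix.mulVec_mulVec, hQQ, Matrix.neg_mulVec,
      Matrix.smul_mulVec]
  have hwQ : w ᵥ* (G⁻¹ * Q) = -(q • w) := by
    rw [← hzQ, Matrix.vecMul_vecMul, ← Matrix.mul_assoc, hQQ, Matrix.vecMul_neg,
      Matrix.vecMul_smul]
  have hwGw : w ⬝ᵥ G⁻¹ *ᵥ w = -(q * m) := by
    have : w ⬝ᵥ G⁻¹ *ᵥ w = z ⬝ᵥ Q *ᵥ (G⁻¹ *ᵥ w) := by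
      rw [Matrix.dotProduct_mulVec z Q, hzQ]
    rw [this, hQw, dotProduct_neg, dotProduct_smul, smul_eq_mul]
  -- `P` and `R` are idempotents of trace one with `PR = RP = R`, and `R` is the rank-one projector
  -- on the line of `G⁻¹w`. So `P - R` is an idempotent of trace zero, and it vanishes because the
  -- trace of an idempotent is its rank.
  set P := -(q⁻¹ • (G⁻¹ * Q)) with hP
  set R := -((q * m)⁻¹ • vecMulVec (G⁻¹ *ᵥ w) w) with hR
  have hPP : P * P = P := by
    rw [hP, Matrix.neg_mul, Matrix.mul_neg, neg_neg, Matrix.smul_mul, Matrix.mul_smul,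
      Matrix.mul_assoc, ← Matrix.mul_assoc Q, hQQ, Matrix.mul_neg, Matrix.mul_smul, smul_neg,
      smul_neg, smul_smul, smul_smul]
    congr 2
    field_simp
  have hPR : P * R = R := by
    rw [hP, hR, Matrix.neg_mul, Matrix.mul_neg, neg_neg, Matrix.smul_mul, Matrix.mul_smul,
      Matrix.mul_assoc, Matrix.mul_vecMulVec, Matrix.mul_vecMulVec, hQw, Matrix.mulVec_neg,
      Matrix.mulVec_smul, Matrix.neg_vecMulVec, Matrix.smul_vecMulVec]
    simp only [smul_neg, smul_smul]
    congr 2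
    field_simp
  have hRP : R * P = R := by
    rw [hP, hR, Matrix.neg_mul, Matrix.mul_neg, neg_neg, Matrix.smul_mul, Matrix.mul_smul,
      Matrix.vecMulVec_mul, hwQ, Matrix.vecMulVec_neg, Matrix.vecMulVec_smul]
    simp only [smul_neg, smul_smul]
    congr 2
    field_simp
  have hRR : R * R = R := by
    rw [hR, Matrix.neg_mul, Matrix.mul_neg, neg_neg, Matrix.smul_mul, Matrix.mul_smul,
      Matrix.vecMulVec_mul_vecMulVec, hwGw]
    ext i j
    simp only [Matrix.smul_apply, Matrix.neg_apply, vecMulVec_apply, Pi.smul_apply, smul_eq_mul]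
    field_simp
  have hPtr : P.trace = 1 := by
    rw [hP, Matrix.trace_neg, Matrix.trace_smul, htr, smul_eq_mul]; field_simp
  have hRtr : R.trace = 1 := by
    rw [hR, Matrix.trace_neg, Matrix.trace_smul, Matrix.trace_vecMulVec, dotProduct_comm, hwGw,
      smul_eq_mul]; field_simp
  have hidem : IsIdempotentElem (Matrix.toLin' (P - R)) := by
    rw [IsIdempotentElem, Module.End.mul_eq_comp, ← Matrix.toLin'_mul]
    congr 1
    rw [Matrix.sub_mul, Matrix.mul_sub, Matrix.mul_sub, hPP, hPR, hRP, hRR, sub_self, sub_zero]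
  have h0 : P - R = 0 := by
    have : Matrix.toLin' (P - R) = 0 := by
      rw [← LinearMap.IsIdempotentElem.trace_eq_zero_iff hidem, Matrix.trace_toLin'_eq,
        Matrix.trace_sub, hPtr, hRtr, sub_self]
    exact (LinearEquiv.map_eq_zero_iff _).1 this
  have h1 : Q = -(q • (G * P)) := by
    rw [hP, Matrix.mul_neg, Matrix.mul_smul, ← Matrix.mul_assoc, Matrix.mul_nonsing_inv _ hG,
      Matrix.one_mul, smul_neg, neg_neg, smul_smul, mul_inv_cancel₀ hq, one_smul]
  rw [h1, sub_eq_zero.1 h0, hR, Matrix.mul_neg, Matrix.mul_smul, Matrix.mul_vecMulVec,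
    Matrix.mulVec_mulVec, Matrix.mul_nonsing_inv _ hG, Matrix.one_mulVec, smul_neg, neg_neg,
    smul_smul]
  congr 1
  field_simp

/-- Orthogonality would make the products of time components and of space parts equal;
Cauchy–Schwarz on the space parts then contradicts that each time component dominates its space
part. -/
theorem lorentz_timelike_ne_zero {G P : Matrix (Fin 4) (Fin 4) ℝ}
    (h : G = Pᵀ * Matrix.diagonal ![-1, 1, 1, 1] * P) {u v : Fin 4 → ℝ}
    (hu : bil G u u < 0) (hv : bil G v v < 0) : bil G v u ≠ 0 := by
  have key : ∀ a b, bil G a b = -((P *ᵥ a) 0 * (P *ᵥ b) 0) + (P *ᵥ a) 1 * (P *ᵥ b) 1 +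
      (P *ᵥ a) 2 * (P *ᵥ b) 2 + (P *ᵥ a) 3 * (P *ᵥ b) 3 := by
    intro a b
    rw [bil_eq, h, Matrix.mul_assoc, ← Matrix.mulVec_mulVec, Matrix.dotProduct_mulVec,
      Matrix.vecMul_transpose, ← Matrix.mulVec_mulVec]
    simp [dotProduct, Fin.sum_univ_four, Matrix.mulVec_diagonal]
  rw [key] at hu hv ⊢
  generalize P *ᵥ u = a at *
  generalize P *ᵥ v = b at *
  intro h0
  have hcs : (b 1 * a 1 + b 2 * a 2 + b 3 * a 3) ^ 2 ≤
      (b 1 ^ 2 + b 2 ^ 2 + b 3 ^ 2) * (a 1 ^ 2 + a 2 ^ 2 + a 3 ^ 2) := by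
    nlinarith [sq_nonneg (b 1 * a 2 - b 2 * a 1), sq_nonneg (b 1 * a 3 - b 3 * a 1),
      sq_nonneg (b 2 * a 3 - b 3 * a 2)]
  have e : b 1 * a 1 + b 2 * a 2 + b 3 * a 3 = b 0 * a 0 := by linarith
  rw [e, mul_pow] at hcs
  have h1 : b 1 ^ 2 + b 2 ^ 2 + b 3 ^ 2 < b 0 ^ 2 := by nlinarith
  have h2 : a 1 ^ 2 + a 2 ^ 2 + a 3 ^ 2 < a 0 ^ 2 := by nlinarith
  have h3 : 0 < a 0 ^ 2 := lt_of_le_of_lt (by positivity) h2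
  have h4 : (b 1 ^ 2 + b 2 ^ 2 + b 3 ^ 2) * (a 1 ^ 2 + a 2 ^ 2 + a 3 ^ 2) ≤
      (b 1 ^ 2 + b 2 ^ 2 + b 3 ^ 2) * a 0 ^ 2 := by
    exact mul_le_mul_of_nonneg_left h2.le (by positivity)
  have h5 := mul_lt_mul_of_pos_right h1 h3
  linarith

theorem lorentz_exists_timelike {G P : Matrix (Fin 4) (Fin 4) ℝ} (hP : IsUnit P.det)
    (h : G = Pᵀ * Matrix.diagonal ![-1, 1, 1, 1] * P) : ∃ v, bil G v v < 0 := by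
  refine ⟨P⁻¹ *ᵥ Pi.single 0 1, ?_⟩
  have : P *ᵥ (P⁻¹ *ᵥ Pi.single 0 1) = (Pi.single 0 1 : Fin 4 → ℝ) := by
    rw [Matrix.mulVec_mulVec, Matrix.mul_nonsing_inv _ hP, Matrix.one_mulVec]
  rw [bil_eq, h, Matrix.mul_assoc, ← Matrix.mulVec_mulVec, Matrix.dotProduct_mulVec,
      Matrix.vecMul_transpose, ← Matrix.mulVec_mulVec, this]
  simp [dotProduct, Fin.sum_univ_four, Matrix.mulVec_diagonal]

/-! ### Conservation of energy -/

theorem pd_sum_mul {ι : Type*} [Fintype ι] {f h : ι → E4 → ℝ} {x : E4}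
    (hf : ∀ a, DifferentiableAt ℝ (f a) x) (hh : ∀ a, DifferentiableAt ℝ (h a) x) (i : Fin 4) :
    pd i (fun y => ∑ a, f a y * h a y) x = ∑ a, (pd i (f a) x * h a x + f a x * pd i (h a) x) := by
  rw [← Finset.sum_congr rfl fun a _ => pd_mul (hf a) (hh a) i]
  exact pd_sum (fun a _ => (hf a).mul (hh a)) i

theorem contDiffAt_mulVec {S : Tensor2} {v : E4 → Fin 4 → ℝ} {x : E4} (hS : SmoothM S x)
    (hv : ∀ i, ContDiffAt ℝ ∞ (fun y => v y i) x) (i : Fin 4) :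
    ContDiffAt ℝ ∞ (fun y => (S y *ᵥ v y) i) x := by
  simp only [Matrix.mulVec, dotProduct]
  exact ContDiffAt.sum fun j _ => (hS i j).mul (hv j)

namespace IsLorentzOn

variable {g : Tensor2} {Ω : Set E4} (hg : IsLorentzOn g Ω) {x : E4} (hx : x ∈ Ω)
include hg hx

/-- The acceleration of a unit vector field is orthogonal to it. -/
theorem unit_acceleration {u : E4 → Fin 4 → ℝ} (hu : ∀ a, ContDiffAt ℝ ∞ (fun y => u y a) x)
    (hunit : ∀ᶠ y in 𝓝 x, bil (g y) (u y) (u y) = -1) (a : Fin 4) :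
    ∑ e, u x e * (pd a (fun y => (g y *ᵥ u y) e) x -
      ∑ m, christoffel g m a e x * (g x *ᵥ u x) m) = 0 := by
  set w : E4 → Fin 4 → ℝ := fun y => g y *ᵥ u y with hw
  have hwd : ∀ e, DifferentiableAt ℝ (fun y => w y e) x :=
    fun e => (contDiffAt_mulVec (hg.smooth x hx) hu e).differentiableAt_infty
  have hud : ∀ e, DifferentiableAt ℝ (fun y => u y e) x := fun e => (hu e).differentiableAt_infty
  set du : Fin 4 → ℝ := fun e => pd a (fun y => u y e) x with hdu
  set dw : Fin 4 → ℝ := fun e => pd a (fun y => w y e) x with hdw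
  have h1 : du ⬝ᵥ w x + u x ⬝ᵥ dw = 0 := by
    rw [← pd_const (-1) x a, pd_congr (g := fun y => ∑ e, u y e * w y e)
      (by filter_upwards [hunit] with y hy; rw [← hy, bil_eq]; rfl),
      pd_sum_mul hud hwd, Finset.sum_add_distrib]
    rfl
  have h2 : dw = pdM a g x *ᵥ u x + g x *ᵥ du := by
    ext e
    exact (pd_sum_mul (fun b => (hg.smooth x hx).diff e b) hud a).trans Finset.sum_add_distrib
  have h3 : u x ⬝ᵥ g x *ᵥ du = du ⬝ᵥ w x := by
    rw [Matrix.dotProduct_mulVec, ← hg.symm hx, Matrix.vecMul_transpose, dotProduct_comm]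
  have h4 : u x ⬝ᵥ pdM a g x *ᵥ u x = 2 * (u x ⬝ᵥ (conn g a x)ᵀ *ᵥ w x) := by
    rw [hg.pdM_metric hx, Matrix.add_mulVec, dotProduct_add, ← Matrix.mulVec_mulVec,
      ← Matrix.mulVec_mulVec, two_mul]
    congr 1
    rw [Matrix.dotProduct_mulVec, ← hg.symm hx, Matrix.vecMul_transpose,
      Matrix.dotProduct_mulVec (u x), Matrix.vecMul_transpose, dotProduct_comm]
  have h5 : ∑ e, u x e * (dw e - ∑ m, christoffel g m a e x * w x m) =
      u x ⬝ᵥ dw - u x ⬝ᵥ (conn g a x)ᵀ *ᵥ w x := by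
    rw [← dotProduct_sub]; rfl
  rw [h5]
  have h6 : u x ⬝ᵥ dw = u x ⬝ᵥ pdM a g x *ᵥ u x + u x ⬝ᵥ g x *ᵥ du := by
    rw [h2, dotProduct_add]
  linarith

/-- The energy of a perfect fluid is conserved. -/
theorem energy_conservation {u : E4 → Fin 4 → ℝ} {ρ p : E4 → ℝ}
    (hu : ∀ a, ContDiffAt ℝ ∞ (fun y => u y a) x)
    (hρ : DifferentiableAt ℝ ρ x) (hp : DifferentiableAt ℝ p x)
    (hunit : ∀ᶠ y in 𝓝 x, bil (g y) (u y) (u y) = -1)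
    (hE : ∀ᶠ y in 𝓝 x, ricci g y - (tS g y / 2) • g y =
      (ρ y + p y) • vecMulVec (g y *ᵥ u y) (g y *ᵥ u y) + p y • g y) :
    along u ρ x + (ρ x + p x) * divergence g u x = 0 := by
  set w : E4 → Fin 4 → ℝ := fun y => g y *ᵥ u y with hw
  have hwd : ∀ e, DifferentiableAt ℝ (fun y => w y e) x :=
    fun e => (contDiffAt_mulVec (hg.smooth x hx) hu e).differentiableAt_infty
  have hud : ∀ e, DifferentiableAt ℝ (fun y => u y e) x := fun e => (hu e).differentiableAt_infty
  have ht : DifferentiableAt ℝ (tS g) x := (hg.smooth_tS hx).differentiableAt_infty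
  set h : E4 → ℝ := fun y => ρ y + p y with hh
  have hhd : DifferentiableAt ℝ h x := hρ.add hp
  set f : E4 → ℝ := fun y => p y + 1 / 2 * tS g y with hf
  have hfd : DifferentiableAt ℝ f x := hp.add (ht.const_mul _)
  have hR : ∀ a e, (fun y => ricciUp g y a e) =ᶠ[𝓝 x]
      fun y => h y * u y a * w y e + f y * (1 : Matrix (Fin 4) (Fin 4) ℝ) a e := by
    intro a e
    filter_upwards [hE, hg.mem_nhds hx] with y hy hyΩ
    have : ricci g y = h y • vecMulVec (w y) (w y) + f y • g y := by
      rw [eq_add_of_sub_eq hy, hf]; module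
    rw [ricciUp, this, Matrix.mul_add, Matrix.mul_smul, Matrix.mul_smul, hg.inv_mul hyΩ,
      Matrix.mul_vecMulVec, hw, Matrix.mulVec_mulVec, hg.inv_mul hyΩ, Matrix.one_mulVec]
    simp only [Matrix.add_apply, Matrix.smul_apply, vecMulVec_apply, smul_eq_mul]
    ring
  have hRx : ∀ a e, ricciUp g x a e =
      h x * u x a * w x e + f x * (1 : Matrix (Fin 4) (Fin 4) ℝ) a e :=
    fun a e => (hR a e).eq_of_nhds
  have hpR : ∀ a e, pd a (fun y => ricciUp g y a e) x =
      (pd a h x * u x a + h x * pd a (fun y => u y a) x) * w x e +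
      h x * u x a * pd a (fun y => w y e) x +
      pd a f x * (1 : Matrix (Fin 4) (Fin 4) ℝ) a e := by
    intro a e
    rw [pd_congr (hR a e)]
    generalize (1 : Matrix (Fin 4) (Fin 4) ℝ) a e = c
    have d1 : DifferentiableAt ℝ (fun y => h y * u y a) x := hhd.mul (hud a)
    have d2 : DifferentiableAt ℝ (fun y => h y * u y a * w y e) x := d1.mul (hwd e)
    rw [pd_add d2 (hfd.mul_const c), pd_mul d1 (hwd e), pd_mul hhd (hud a),
      pd_mul hfd (differentiableAt_const c), pd_const]
    ring
  have hpf : ∀ e, pd e f x = pd e p x + 1 / 2 * pd e (tS g) x := fun e => by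
    rw [hf, pd_add hp (ht.const_mul _), pd_const_mul ht]
  have hph : ∀ e, pd e h x = pd e ρ x + pd e p x := fun e => pd_add hρ hp e
  -- The contracted Bianchi identity for `R = h u ⊗ u + f g`: the gradient of `tS` inside `f`
  -- cancels the right-hand side, and what remains is the vanishing divergence of the energy tensor,
  -- with the acceleration of `u` as last term.
  have hB : ∀ e, (∑ a, (pd a h x * u x a + h x * pd a (fun y => u y a) x) +
      h x * ∑ a, ∑ m, christoffel g a a m x * u x m) * w x e + pd e p x +
      h x * ∑ a, u x a * (pd a (fun y => w y e) x - ∑ m, christoffel g m a e x * w x m) = 0 := by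
    intro e
    have h0 := hg.contracted_bianchi hx e
    simp only [hpR, hRx, Matrix.one_apply, mul_add, mul_ite, mul_one, mul_zero,
      Finset.sum_add_distrib, Finset.sum_ite_eq, Finset.sum_ite_eq', Finset.mem_univ, if_true,
      hpf] at h0
    have e1 : ∑ a, h x * u x a * pd a (fun y => w y e) x =
        h x * ∑ a, u x a * pd a (fun y => w y e) x := by
      rw [Finset.mul_sum]; exact Finset.sum_congr rfl fun a _ => by ring
    have e2 : ∑ a, (pd a h x * u x a + h x * pd a (fun y => u y a) x) * w x e =
        (∑ a, (pd a h x * u x a + h x * pd a (fun y => u y a) x)) * w x e := by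
      rw [Finset.sum_mul]
    have e3 : ∑ a, ∑ m, christoffel g a a m x * (h x * u x m * w x e) =
        h x * (∑ a, ∑ m, christoffel g a a m x * u x m) * w x e := by
      simp only [Finset.mul_sum, Finset.sum_mul]
      exact Finset.sum_congr rfl fun a _ => Finset.sum_congr rfl fun m _ => by ring
    have e4 : ∑ a, ∑ m, christoffel g m a e x * (h x * u x a * w x m) =
        h x * ∑ a, u x a * ∑ m, christoffel g m a e x * w x m := by
      simp only [Finset.mul_sum]
      exact Finset.sum_congr rfl fun a _ => Finset.sum_congr rfl fun m _ => by ring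
    rw [e1, e2, e3, e4] at h0
    simp only [mul_sub, Finset.sum_sub_distrib]
    linarith
  have hA : ∑ a, (pd a h x * u x a + h x * pd a (fun y => u y a) x) +
      h x * ∑ a, ∑ m, christoffel g a a m x * u x m =
      along u ρ x + along u p x + h x * divergence g u x := by
    simp only [Finset.sum_add_distrib, divergence, along, hph, ← Finset.mul_sum, mul_add, add_mul,
      mul_comm (u x _)]
    ring
  rw [hA] at hB
  have h7 : ∑ e, u x e * w x e = -1 := by rw [← hunit.self_of_nhds, bil_eq]; rfl
  -- Contraction with `u`: the acceleration term drops out by `unit_acceleration`, and the two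
  -- occurrences of `u(p)` cancel.
  have h8 : ∑ e, u x e * ((along u ρ x + along u p x + h x * divergence g u x) * w x e) +
      ∑ e, u x e * pd e p x + ∑ e, u x e * (h x * ∑ a, u x a * (pd a (fun y => w y e) x -
        ∑ m, christoffel g m a e x * w x m)) = 0 := by
    rw [← Finset.sum_add_distrib, ← Finset.sum_add_distrib]
    exact Finset.sum_eq_zero fun e _ => by rw [← mul_add, ← mul_add, hB, mul_zero]
  have h9 : ∑ e, u x e * (h x * ∑ a, u x a * (pd a (fun y => w y e) x -
        ∑ m, christoffel g m a e x * w x m)) = 0 := by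
    simp only [Finset.mul_sum]
    rw [Finset.sum_comm]
    refine Finset.sum_eq_zero fun a _ => ?_
    rw [← mul_zero (h x * u x a), ← hg.unit_acceleration hx hu hunit a, Finset.mul_sum]
    exact Finset.sum_congr rfl fun e _ => by ring
  have h10 : ∑ e, u x e * ((along u ρ x + along u p x + h x * divergence g u x) * w x e) =
      -(along u ρ x + along u p x + h x * divergence g u x) := by
    rw [← mul_neg_one, ← h7, Finset.mul_sum]
    exact Finset.sum_congr rfl fun e _ => by ring
  rw [h9, h10, add_zero] at h8
  change _ + along u p x = 0 at h8
  change _ + h x * _ = _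
  linarith

end IsLorentzOn

/-! ### Thermodynamics of a generic ideal gas -/

theorem fderiv_fderiv_comm {E : Type*} [NormedAddCommGroup E] [NormedSpace ℝ E] {f : E → ℝ} {x : E}
    (hf : ContDiffAt ℝ ∞ f x) (a b : E) :
    fderiv ℝ (fun y => fderiv ℝ f y a) x b = fderiv ℝ (fun y => fderiv ℝ f y b) x a := by
  have hd : DifferentiableAt ℝ (fderiv ℝ f) x :=
    (hf.fderiv_right (m := ∞) (by simp)).differentiableAt_infty
  rw [fderiv_clm_apply hd (differentiableAt_const _),
    fderiv_clm_apply hd (differentiableAt_const _)]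
  simpa using ((contDiffAt_infty.1 hf 2).isSymmSndFDerivAt (by simp)).eq b a

theorem deriv_slice_snd {φ : ℝ × ℝ → ℝ} {w : ℝ × ℝ} (h : DifferentiableAt ℝ φ w) :
    deriv (fun p => φ (w.1, p)) w.2 = fderiv ℝ φ w (0, 1) :=
  (h.hasFDerivAt.comp_hasDerivAt (x := w.2) (f := fun p => (w.1, p)) (f' := ((0, 1) : ℝ × ℝ))
    ((hasDerivAt_const _ _).prodMk (hasDerivAt_id _))).deriv

theorem deriv_slice_fst {φ : ℝ × ℝ → ℝ} {w : ℝ × ℝ} (h : DifferentiableAt ℝ φ w) :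
    deriv (fun s => φ (s, w.2)) w.1 = fderiv ℝ φ w (1, 0) :=
  (h.hasFDerivAt.comp_hasDerivAt (x := w.1) (f := fun s => (s, w.2)) (f' := ((1, 0) : ℝ × ℝ))
    ((hasDerivAt_id _).prodMk (hasDerivAt_const _ _))).deriv

theorem fderiv_mul_apply {E : Type*} [NormedAddCommGroup E] [NormedSpace ℝ E] {f g : E → ℝ} {x : E}
    (hf : DifferentiableAt ℝ f x) (hg : DifferentiableAt ℝ g x) (h : E) :
    fderiv ℝ (fun y => f y * g y) x h = fderiv ℝ f x h * g x + f x * fderiv ℝ g x h := by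
  rw [fderiv_fun_mul hf hg]
  simp only [_root_.add_apply, _root_.smul_apply, smul_eq_mul]
  ring

theorem fderiv_div_apply {E : Type*} [NormedAddCommGroup E] [NormedSpace ℝ E] {f g : E → ℝ} {x : E}
    (hf : DifferentiableAt ℝ f x) (hg : DifferentiableAt ℝ g x) (h0 : g x ≠ 0) (h : E) :
    fderiv ℝ (fun y => f y / g y) x h =
      (fderiv ℝ f x h * g x - f x * fderiv ℝ g x h) / g x ^ 2 := by
  have hd : DifferentiableAt ℝ (fun y => f y / g y) x := by
    simp only [div_eq_mul_inv]; exact hf.fun_mul (hg.inv h0)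
  have key := fderiv_mul_apply hd hg h
  have he : (fun y => f y / g y * g y) =ᶠ[𝓝 x] f := by
    filter_upwards [hg.continuousAt.eventually_ne h0] with y hy
    field_simp
  rw [he.fderiv_eq] at key
  rw [key]
  field_simp
  ring

theorem fderiv_add_apply {E : Type*} [NormedAddCommGroup E] [NormedSpace ℝ E] {f g : E → ℝ} {x : E}
    (hf : DifferentiableAt ℝ f x) (hg : DifferentiableAt ℝ g x) (h : E) :
    fderiv ℝ (fun y => f y + g y) x h = fderiv ℝ f x h + fderiv ℝ g x h := by
  rw [fderiv_fun_add hf hg]; rfl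

theorem fderiv_sub_apply {E : Type*} [NormedAddCommGroup E] [NormedSpace ℝ E] {f g : E → ℝ} {x : E}
    (hf : DifferentiableAt ℝ f x) (hg : DifferentiableAt ℝ g x) (h : E) :
    fderiv ℝ (fun y => f y - g y) x h = fderiv ℝ f x h - fderiv ℝ g x h := by
  rw [fderiv_fun_sub hf hg]; rfl

theorem fderiv_snd_apply (w h : ℝ × ℝ) : fderiv ℝ (fun w : ℝ × ℝ => w.2) w h = h.2 := by
  rw [_root_.fderiv_snd]; rfl

namespace IdealGas

variable {k : ℝ} (G : IdealGas k) {w : ℝ × ℝ} (hw : w ∈ G.dom)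

/-- The derivative `(ρ'ₚ)ₛ` of the energy density. -/
def ρp (w : ℝ × ℝ) : ℝ := fderiv ℝ G.ρ w (0, 1)

include hw

theorem dom_mem : G.dom ∈ 𝓝 w := G.isOpen_dom.mem_nhds hw

theorem contDiffAt_r : ContDiffAt ℝ ∞ G.r w := G.smooth_r.contDiffAt (G.dom_mem hw)

theorem contDiffAt_ε : ContDiffAt ℝ ∞ G.ε w := G.smooth_ε.contDiffAt (G.dom_mem hw)

theorem contDiffAt_Θ : ContDiffAt ℝ ∞ G.Θ w := G.smooth_Θ.contDiffAt (G.dom_mem hw)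

theorem contDiffAt_v : ContDiffAt ℝ ∞ G.v w :=
  contDiffAt_const.div (G.contDiffAt_r hw) (G.r_pos w hw).ne'

theorem contDiffAt_ρ : ContDiffAt ℝ ∞ G.ρ w :=
  (G.contDiffAt_r hw).mul (contDiffAt_const.add (G.contDiffAt_ε hw))

theorem contDiffAt_τ : ContDiffAt ℝ ∞ G.τ w :=
  (contDiffAt_const.add ((G.contDiffAt_ε hw).add (contDiffAt_snd.mul (G.contDiffAt_v hw)))).mul
    (G.contDiffAt_v hw)

theorem contDiffAt_ρp : ContDiffAt ℝ ∞ G.ρp w :=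
  ((G.contDiffAt_ρ hw).fderiv_right (m := ∞) (by simp)).clm_apply contDiffAt_const

theorem p_pos (hk : 0 < k) : 0 < w.2 := by
  rw [G.ideal w hw]
  exact mul_pos (mul_pos hk (G.r_pos w hw)) (G.Θ_pos w hw)

theorem fderiv_v (h : ℝ × ℝ) : fderiv ℝ G.v w h = -fderiv ℝ G.r w h / G.r w ^ 2 := by
  have := fderiv_div_apply (differentiableAt_const (1 : ℝ))
    (G.contDiffAt_r hw).differentiableAt_infty (G.r_pos w hw).ne' h
  unfold v
  rw [this]; simp

theorem fderiv_ε (h : ℝ × ℝ) :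
    fderiv ℝ G.ε w h = G.Θ w * h.1 + w.2 * fderiv ℝ G.r w h / G.r w ^ 2 := by
  have h1 := G.balance w hw h
  change _ = _ + w.2 * fderiv ℝ G.v w h at h1
  rw [G.fderiv_v hw] at h1
  linear_combination -h1

/-- The Gibbs relation for the energy density. Its first term is governed by conservation of matter,
so that the second isolates the production of entropy. -/
theorem fderiv_ρ (h : ℝ × ℝ) : fderiv ℝ G.ρ w h =
    (G.ρ w + w.2) / G.r w * fderiv ℝ G.r w h + G.r w * G.Θ w * h.1 := by
  have hε := (G.contDiffAt_ε hw).differentiableAt_infty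
  have hr := (G.r_pos w hw).ne'
  have h1 : fderiv ℝ G.ρ w h = fderiv ℝ G.r w h * (1 + G.ε w) + G.r w * fderiv ℝ G.ε w h := by
    have := fderiv_mul_apply (G.contDiffAt_r hw).differentiableAt_infty
      ((differentiableAt_const (1 : ℝ)).fun_add hε) h
    rwa [fderiv_const_add] at this
  rw [h1, G.fderiv_ε hw, ρ]
  field_simp
  ring

/-- `k v'ₛ = v + p v'ₚ`, from the equality of the mixed derivatives of the enthalpy. -/
theorem fderiv_v_scaling :
    k * fderiv ℝ G.v w (1, 0) = G.v w + w.2 * fderiv ℝ G.v w (0, 1) := by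
  set η : ℝ × ℝ → ℝ := fun w => G.ε w + w.2 * G.v w with hη
  have hηs : ContDiffAt ℝ ∞ η w :=
    (G.contDiffAt_ε hw).add (contDiffAt_snd.mul (G.contDiffAt_v hw))
  have hdη : ∀ w ∈ G.dom, ∀ h : ℝ × ℝ, fderiv ℝ η w h = G.Θ w * h.1 + h.2 * G.v w := by
    intro w hw h
    have hv := (G.contDiffAt_v hw).differentiableAt_infty
    rw [hη, fderiv_add_apply (G.contDiffAt_ε hw).differentiableAt_infty
      (differentiableAt_snd.fun_mul hv), fderiv_mul_apply differentiableAt_snd hv,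
      fderiv_snd_apply, G.balance w hw h]
    change _ = _ + w.2 * fderiv ℝ G.v w h + _
    ring
  have h1 := fderiv_fderiv_comm hηs (0, 1) (1, 0)
  have e1 : (fun y => fderiv ℝ η y (0, 1)) =ᶠ[𝓝 w] G.v := by
    filter_upwards [G.dom_mem hw] with y hy
    rw [hdη y hy]; simp
  have e2 : (fun y => fderiv ℝ η y (1, 0)) =ᶠ[𝓝 w] G.Θ := by
    filter_upwards [G.dom_mem hw] with y hy
    rw [hdη y hy]; simp
  -- The Maxwell relation is `v'ₛ = Θ'ₚ`; the equation of state `kΘ = pv` turns it into an equation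
  -- for `v` alone.
  have e3 : (fun y => k * G.Θ y) =ᶠ[𝓝 w] fun y => y.2 * G.v y := by
    filter_upwards [G.dom_mem hw] with y hy
    have := G.r_pos y hy
    rw [v, G.ideal y hy]; field_simp
  have h2 : k * fderiv ℝ G.Θ w (0, 1) = 1 * G.v w + w.2 * fderiv ℝ G.v w (0, 1) := by
    have := fderiv_mul_apply differentiableAt_snd (G.contDiffAt_v hw).differentiableAt_infty (0, 1)
    rw [fderiv_snd_apply] at this
    rw [← this, ← e3.fderiv_eq, fderiv_const_mul (G.contDiffAt_Θ hw).differentiableAt_infty]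
    rfl
  rw [e1.fderiv_eq, e2.fderiv_eq] at h1
  rw [h1, h2, one_mul]

theorem fderiv_r_scaling :
    k * fderiv ℝ G.r w (1, 0) = w.2 * fderiv ℝ G.r w (0, 1) - G.r w := by
  have h := G.fderiv_v_scaling hw
  have hr := (G.r_pos w hw).ne'
  rw [G.fderiv_v hw, G.fderiv_v hw, v] at h
  field_simp at h
  linear_combination -h

/-- Along the field `k∂ₛ - p∂ₚ` both `ρ` and `p` have weight `-1`. Hence `p/ρ` is invariant, that
is, a function of `s/k + ln p`. -/
theorem fderiv_ρ_scaling : k * fderiv ℝ G.ρ w (1, 0) = w.2 * G.ρp w - G.ρ w := by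
  have hr := (G.r_pos w hw).ne'
  have h1 := G.fderiv_r_scaling hw
  have h2 := G.ideal w hw
  rw [ρp, G.fderiv_ρ hw, G.fderiv_ρ hw]
  have h3 : k * ((G.ρ w + w.2) / G.r w * fderiv ℝ G.r w (1, 0)) =
      (G.ρ w + w.2) / G.r w * (w.2 * fderiv ℝ G.r w (0, 1) - G.r w) := by
    rw [← h1]; ring
  have h4 : (G.ρ w + w.2) / G.r w * G.r w = G.ρ w + w.2 := by field_simp
  simp only
  linear_combination h3 - h4 - h2

/-- The `p`-derivative of `fderiv_ρ_scaling`: `ρ'ₚ` has weight zero, so it too depends on `s/k + ln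
p` only. This is the source of `dχ ∧ dπ = 0`. -/
theorem fderiv_ρp_scaling :
    k * fderiv ℝ G.ρp w (1, 0) = w.2 * fderiv ℝ G.ρp w (0, 1) := by
  have e : (fun y => k * fderiv ℝ G.ρ y (1, 0)) =ᶠ[𝓝 w] fun y => y.2 * G.ρp y - G.ρ y := by
    filter_upwards [G.dom_mem hw] with y hy using G.fderiv_ρ_scaling hy
  have hρp := (G.contDiffAt_ρp hw).differentiableAt_infty
  have hρ := (G.contDiffAt_ρ hw).differentiableAt_infty
  have hρs : DifferentiableAt ℝ (fun y => fderiv ℝ G.ρ y (1, 0)) w :=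
    (((G.contDiffAt_ρ hw).fderiv_right (m := ∞) (by simp)).clm_apply
      contDiffAt_const).differentiableAt_infty
  have h := DFunLike.congr_fun (e.fderiv_eq (𝕜 := ℝ)) ((0, 1) : ℝ × ℝ)
  rw [fderiv_sub_apply (differentiableAt_snd.fun_mul hρp) hρ,
    fderiv_mul_apply differentiableAt_snd hρp, fderiv_snd_apply, fderiv_const_mul hρs,
    _root_.smul_apply, fderiv_fderiv_comm (G.contDiffAt_ρ hw) (1, 0) (0, 1)] at h
  change k * fderiv ℝ G.ρp w (1, 0) = 1 * G.ρp w + w.2 * fderiv ℝ G.ρp w (0, 1) - G.ρp w at h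
  rw [h]; ring

theorem τ_eq : G.τ w = (G.ρ w + w.2) / (G.r w * G.r w) := by
  have hr := (G.r_pos w hw).ne'
  rw [τ, v, ρ]; field_simp; ring

theorem fderiv_τ (h : ℝ × ℝ) : fderiv ℝ G.τ w h =
    (fderiv ℝ G.ρ w h + h.2) / G.r w ^ 2 -
      2 * (G.ρ w + w.2) * fderiv ℝ G.r w h / G.r w ^ 3 := by
  have hr := (G.r_pos w hw).ne'
  have hrd := (G.contDiffAt_r hw).differentiableAt_infty
  have hρ := (G.contDiffAt_ρ hw).differentiableAt_infty
  have e : G.τ =ᶠ[𝓝 w] fun y => (G.ρ y + y.2) / (G.r y * G.r y) := by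
    filter_upwards [G.dom_mem hw] with y hy using G.τ_eq hy
  rw [e.fderiv_eq, fderiv_div_apply (hρ.fun_add differentiableAt_snd) (hrd.fun_mul hrd)
    (mul_ne_zero hr hr), fderiv_add_apply hρ differentiableAt_snd, fderiv_snd_apply,
    fderiv_mul_apply hrd hrd]
  field_simp
  ring

/-- At constant entropy `(ρ + p) r'ₚ = r ρ'ₚ`, which eliminates the derivative of `r` from that of
`τ = (ρ + p)/r²`. -/
theorem fderiv_τ_snd : fderiv ℝ G.τ w (0, 1) = (1 - G.ρp w) / (G.r w * G.r w) := by
  have hr := (G.r_pos w hw).ne'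
  have h := G.fderiv_ρ hw (0, 1)
  rw [G.fderiv_τ hw]
  rw [← ρp] at h ⊢
  simp only [mul_zero, add_zero] at h ⊢
  have h' : (G.ρ w + w.2) * fderiv ℝ G.r w (0, 1) = G.ρp w * G.r w := by
    rw [h]; field_simp
  rw [mul_assoc, h']
  field_simp
  ring

theorem one_lt_ρp (h1 : G.H1) : 1 < G.ρp w := by
  have h := (h1 w hw).1
  rw [deriv_slice_snd (G.contDiffAt_τ hw).differentiableAt_infty, G.fderiv_τ_snd hw,
    div_neg_iff] at h
  have := G.r_pos w hw
  rcases h with h | h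
  · nlinarith [h.2, mul_pos this this]
  · linarith [h.1]

/-- The second inequality of `H₁`, obtained by differentiating `(1 - ρ'ₚ)/r²`, eliminating `r'ₚ` as
before and clearing positive factors. -/
theorem ρp_convexity (h1 : G.H1) (hpos : 0 < G.ρ w + w.2) :
    0 < -((G.ρ w + w.2) * fderiv ℝ G.ρp w (0, 1)) + 2 * (G.ρp w - 1) * G.ρp w := by
  have hr := G.r_pos w hw
  have h := (h1 w hw).2
  have hrd := (G.contDiffAt_r hw).differentiableAt_infty
  have hρp := (G.contDiffAt_ρp hw).differentiableAt_infty
  have e : deriv (fun p => G.τ (w.1, p)) =ᶠ[𝓝 w.2]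
      fun p => (fun y => (1 - G.ρp y) / (G.r y * G.r y)) (w.1, p) := by
    have hc : ContinuousAt (fun p : ℝ => (w.1, p)) w.2 := by fun_prop
    filter_upwards [hc.preimage_mem_nhds (G.dom_mem hw)] with p hp
    rw [deriv_slice_snd (w := (w.1, p)) (G.contDiffAt_τ hp).differentiableAt_infty,
      G.fderiv_τ_snd hp]
  have hd1 : DifferentiableAt ℝ (fun y => 1 - G.ρp y) w := hρp.const_sub 1
  have hd2 : DifferentiableAt ℝ (fun y => G.r y * G.r y) w := hrd.fun_mul hrd
  have hd : DifferentiableAt ℝ (fun y => (1 - G.ρp y) / (G.r y * G.r y)) w := by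
    simp only [div_eq_mul_inv]; exact hd1.fun_mul (hd2.inv (mul_pos hr hr).ne')
  rw [e.deriv_eq, deriv_slice_snd hd, fderiv_div_apply hd1 hd2 (mul_pos hr hr).ne',
    fderiv_const_sub, fderiv_mul_apply hrd hrd] at h
  have h2 := G.fderiv_ρ hw (0, 1)
  rw [← ρp] at h2
  simp only [mul_zero, add_zero] at h2
  have h' : (G.ρ w + w.2) * fderiv ℝ G.r w (0, 1) = G.ρp w * G.r w := by
    rw [h2]; field_simp
  change 0 < (-(fderiv ℝ G.ρp w (0, 1)) * _ - _) / _ at h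
  generalize fderiv ℝ G.ρp w (0, 1) = A at *
  generalize fderiv ℝ G.r w (0, 1) = B at *
  have h3 := mul_pos h (mul_pos hpos (pow_pos hr 2))
  have e3 : (-A * (G.r w * G.r w) - (1 - G.ρp w) * (B * G.r w + G.r w * B)) /
      (G.r w * G.r w) ^ 2 * ((G.ρ w + w.2) * G.r w ^ 2) =
      (-A * (G.ρ w + w.2) * G.r w - 2 * (1 - G.ρp w) * ((G.ρ w + w.2) * B)) / G.r w := by
    field_simp; ring
  rw [e3, h'] at h3
  have e4 : (-A * (G.ρ w + w.2) * G.r w - 2 * (1 - G.ρp w) * (G.ρp w * G.r w)) / G.r w =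
      -((G.ρ w + w.2) * A) + 2 * (G.ρp w - 1) * G.ρp w := by field_simp; ring
  rwa [e4] at h3

/-- The scaling relations trade entropy derivatives for pressure derivatives: `k r² τ'ₛ = (pρ'ₚ - ρ)
- 2(pρ'ₚ - (ρ + p))`, which is `ρ + 2p - pρ'ₚ`. -/
theorem mul_ρp_lt (hk : 0 < k) (h2 : G.H2) : w.2 * G.ρp w < G.ρ w + 2 * w.2 := by
  have hr := G.r_pos w hw
  have h := h2 w hw
  rw [deriv_slice_fst (G.contDiffAt_τ hw).differentiableAt_infty, G.fderiv_τ hw] at h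
  have h3 := mul_pos h (mul_pos hk (pow_pos hr 2))
  have e : ((fderiv ℝ G.ρ w (1, 0) + (0 : ℝ)) / G.r w ^ 2 -
      2 * (G.ρ w + w.2) * fderiv ℝ G.r w (1, 0) / G.r w ^ 3) * (k * G.r w ^ 2) =
      k * fderiv ℝ G.ρ w (1, 0) -
        2 * ((G.ρ w + w.2) / G.r w * (k * fderiv ℝ G.r w (1, 0))) := by
    field_simp; ring
  have h4 := G.fderiv_ρ hw (0, 1)
  rw [← ρp] at h4
  rw [e, G.fderiv_ρ_scaling hw, G.fderiv_r_scaling hw] at h3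
  have e2 : (G.ρ w + w.2) / G.r w * (w.2 * fderiv ℝ G.r w (0, 1) - G.r w) =
      w.2 * ((G.ρ w + w.2) / G.r w * fderiv ℝ G.r w (0, 1)) - (G.ρ w + w.2) := by
    field_simp
  simp only [mul_zero, add_zero] at h4
  rw [e2, ← h4] at h3
  linarith

theorem mul_ρp_ne (hk : 0 < k) : w.2 * G.ρp w ≠ G.ρ w := by
  intro h
  have h1 := G.nonbarotropic w hw
  have h2 := G.fderiv_ρ_scaling hw
  rw [h, sub_self, mul_eq_zero] at h2
  change deriv (fun s => G.ρ (s, w.2)) w.1 ≠ 0 at h1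
  rw [deriv_slice_fst (G.contDiffAt_ρ hw).differentiableAt_infty] at h1
  exact h2.elim hk.ne' h1

end IdealGas

/-! ### An ideal gas solution satisfies the Rainich conditions -/

theorem raise_dotProduct {g : Tensor2} {x : E4} (hdet : IsUnit (g x).det) (hs : (g x)ᵀ = g x)
    (α u : Fin 4 → ℝ) : raise g x α ⬝ᵥ g x *ᵥ u = u ⬝ᵥ α := by
  rw [raise_eq, Matrix.dotProduct_mulVec, ← hs, Matrix.vecMul_transpose, hs, Matrix.mulVec_mulVec,
    Matrix.mul_nonsing_inv _ hdet, Matrix.one_mulVec, dotProduct_comm]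

/-- When `Q` is `c` times the square of the covector of `u`, `Q(df, dh) = c u(f) u(h)`. -/
theorem chiS_eq {g : Tensor2} {x : E4} (hdet : IsUnit (g x).det) (hs : (g x)ᵀ = g x)
    {u : E4 → Fin 4 → ℝ} {c : ℝ} (hc : c ≠ 0)
    (hQ : tQ g x = c • vecMulVec (g x *ᵥ u x) (g x *ᵥ u x)) (h0 : along u (rhoS g) x ≠ 0) :
    chiS g x = along u (pS g) x / along u (rhoS g) x := by
  have h : ∀ f, u x ⬝ᵥ dif f x = along u f x := fun _ => rfl
  rw [chiS, hQ, bil_vecMulVec, bil_vecMulVec, raise_dotProduct hdet hs, raise_dotProduct hdet hs,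
    h, h]
  field_simp

theorem along_pair {φ : ℝ × ℝ → ℝ} {s p : E4 → ℝ} {x : E4}
    (hφ : DifferentiableAt ℝ φ (s x, p x)) (hs : DifferentiableAt ℝ s x)
    (hp : DifferentiableAt ℝ p x) (v : E4) :
    fderiv ℝ (fun y => φ (s y, p y)) x v =
      fderiv ℝ φ (s x, p x) (fderiv ℝ s x v, fderiv ℝ p x v) := by
  have h := (hφ.hasFDerivAt.comp x (hs.hasFDerivAt.prodMk hp.hasFDerivAt)).fderiv
  change fderiv ℝ (fun y => φ (s y, p y)) x = _ at h
  rw [h]; rfl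

theorem fderiv_prod_apply (φ : ℝ × ℝ → ℝ) (w : ℝ × ℝ) (a b : ℝ) :
    fderiv ℝ φ w (a, b) = a * fderiv ℝ φ w (1, 0) + b * fderiv ℝ φ w (0, 1) := by
  have : ((a, b) : ℝ × ℝ) = a • (1, 0) + b • (0, 1) := by simp
  rw [this, map_add, map_smul, map_smul]; rfl

theorem smul_vecMulVec_sq {G : Matrix (Fin 4) (Fin 4) ℝ} (hG : IsUnit G.det) {u : Fin 4 → ℝ}
    (hu : bil G u u = -1) (c : ℝ) :
    (c • vecMulVec (G *ᵥ u) (G *ᵥ u)) * G⁻¹ * (c • vecMulVec (G *ᵥ u) (G *ᵥ u)) +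
      c • (c • vecMulVec (G *ᵥ u) (G *ᵥ u)) = 0 := by
  rw [bil_eq] at hu
  rw [Matrix.mul_assoc, Matrix.mul_smul, Matrix.mul_vecMulVec, Matrix.mulVec_mulVec,
    Matrix.nonsing_inv_mul _ hG, Matrix.one_mulVec, Matrix.smul_mul, Matrix.mul_smul,
    Matrix.vecMulVec_mul_vecMulVec, dotProduct_comm, hu]
  ext i j
  simp [vecMulVec_apply]

namespace IsIdealGasSolutionOn

variable {k : ℝ} {G : IdealGas k} {g : Tensor2} {V Ω : Set E4} {u : E4 → Fin 4 → ℝ}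
  {ρ p s : E4 → ℝ} (hS : IsIdealGasSolutionOn G g V u ρ p s) (hV : IsOpen V)
  (hg : IsLorentzOn g Ω) (hVΩ : V ⊆ Ω) {x : E4} (hx : x ∈ V)
include hS hV hx

theorem contDiffAt_u (a : Fin 4) : ContDiffAt ℝ ∞ (fun y => u y a) x :=
  (hS.smooth_u a).contDiffAt (hV.mem_nhds hx)

theorem contDiffAt_ρ : ContDiffAt ℝ ∞ ρ x := hS.smooth_ρ.contDiffAt (hV.mem_nhds hx)

theorem contDiffAt_p : ContDiffAt ℝ ∞ p x := hS.smooth_p.contDiffAt (hV.mem_nhds hx)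

theorem contDiffAt_s : ContDiffAt ℝ ∞ s x := hS.smooth_s.contDiffAt (hV.mem_nhds hx)

theorem fderiv_comp {φ : ℝ × ℝ → ℝ} (hφ : DifferentiableAt ℝ φ (s x, p x)) (v : E4) :
    fderiv ℝ (fun y => φ (s y, p y)) x v =
      fderiv ℝ φ (s x, p x) (fderiv ℝ s x v, fderiv ℝ p x v) :=
  along_pair hφ (hS.contDiffAt_s hV hx).differentiableAt_infty
    (hS.contDiffAt_p hV hx).differentiableAt_infty v

theorem fderiv_energy (v : E4) : fderiv ℝ ρ x v =
    fderiv ℝ G.ρ (s x, p x) (fderiv ℝ s x v, fderiv ℝ p x v) := by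
  have h : ρ =ᶠ[𝓝 x] fun y => G.ρ (s y, p y) := by
    filter_upwards [hV.mem_nhds hx] with y hy using hS.energy y hy
  rw [h.fderiv_eq, hS.fderiv_comp hV hx
    (G.contDiffAt_ρ (hS.state_mem x hx)).differentiableAt_infty]

include hg hVΩ

omit hV in
theorem concomitants : tS g x = ρ x - 3 * p x ∧ qS g x = ρ x + p x ∧
    tQ g x = (ρ x + p x) • vecMulVec (g x *ᵥ u x) (g x *ᵥ u x) :=
  concomitants_of_einstein (hg.det (hVΩ hx)) (hS.unit x hx) (hS.einstein x hx)

omit hV in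
theorem rhoS_eq : rhoS g x = ρ x := by
  obtain ⟨h1, h2, -⟩ := hS.concomitants hg hVΩ hx
  rw [rhoS, h1, h2]; ring

omit hV in
theorem pS_eq : pS g x = p x := by
  obtain ⟨h1, h2, -⟩ := hS.concomitants hg hVΩ hx
  rw [pS, h1, h2]; ring

theorem rhoS_eventuallyEq : rhoS g =ᶠ[𝓝 x] ρ := by
  filter_upwards [hV.mem_nhds hx] with y hy using hS.rhoS_eq hg hVΩ hy

theorem pS_eventuallyEq : pS g =ᶠ[𝓝 x] p := by
  filter_upwards [hV.mem_nhds hx] with y hy using hS.pS_eq hg hVΩ hy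

/-- The evolution is isentropic. -/
theorem along_entropy : fderiv ℝ s x (vec (u x)) = 0 := by
  have hw := hS.state_mem x hx
  have hr := G.r_pos _ hw
  have h1 := hg.energy_conservation (hVΩ hx) (hS.contDiffAt_u hV hx)
    (hS.contDiffAt_ρ hV hx).differentiableAt_infty (hS.contDiffAt_p hV hx).differentiableAt_infty
    (by filter_upwards [hV.mem_nhds hx] with y hy using hS.unit y hy)
    (by filter_upwards [hV.mem_nhds hx] with y hy using hS.einstein y hy)
  have h2 := hS.matter x hx
  rw [along_eq, hS.fderiv_energy hV hx, G.fderiv_ρ hw, ← hS.energy x hx] at h1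
  rw [along_eq, hS.fderiv_comp hV hx (G.contDiffAt_r hw).differentiableAt_infty] at h2
  -- Conservation of energy minus `(ρ + p)/r` times conservation of matter: only the entropy term of
  -- the Gibbs relation survives.
  have h3 : G.r (s x, p x) * G.Θ (s x, p x) * fderiv ℝ s x (vec (u x)) = 0 := by
    have h4 : (ρ x + p x) / G.r (s x, p x) * (fderiv ℝ G.r (s x, p x)
        (fderiv ℝ s x (vec (u x)), fderiv ℝ p x (vec (u x))) + G.r (s x, p x) *
        divergence g u x) = 0 := by rw [h2, mul_zero]
    rw [mul_add, ← mul_assoc, div_mul_cancel₀ _ hr.ne'] at h4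
    simp only at h1
    linarith
  exact (mul_eq_zero.1 h3).resolve_left (mul_pos hr (G.Θ_pos _ hw)).ne'

/-- The entropy is constant along `u`, hence `u(ρ) = (ρ'ₚ)ₛ u(p)`. -/
theorem chiS_eq : chiS g x = 1 / G.ρp (s x, p x) := by
  obtain ⟨-, -, hQ⟩ := hS.concomitants hg hVΩ hx
  have h0 := hS.nonisoenergetic x hx
  have hρ : along u (rhoS g) x = along u ρ x :=
    along_congr (hS.rhoS_eventuallyEq hV hg hVΩ hx) u
  have hp : along u (pS g) x = along u p x := along_congr (hS.pS_eventuallyEq hV hg hVΩ hx) u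
  have h1 : along u ρ x = along u p x * G.ρp (s x, p x) := by
    rw [along_eq, hS.fderiv_energy hV hx, hS.along_entropy hV hg hVΩ hx, fderiv_prod_apply,
      along_eq, zero_mul, zero_add]
    rfl
  have hc : ρ x + p x ≠ 0 := by have := hS.p_nonneg x hx; have := hS.p_lt_ρ x hx; linarith
  rw [Rainich.chiS_eq (hg.det (hVΩ hx)) (hg.symm (hVΩ hx)) hc hQ (hρ ▸ h0), hρ, hp]
  rw [h1] at h0 ⊢
  have h2 := left_ne_zero_of_mul h0
  have h3 := right_ne_zero_of_mul h0
  field_simp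

theorem rainich (hk : 0 < k) (h1 : G.H1) (h2 : G.H2) : RainichConditions g x := by
  obtain ⟨ht, hq, hQ⟩ := hS.concomitants hg hVΩ hx
  have hw := hS.state_mem x hx
  have hp0 : 0 < p x := G.p_pos hw hk
  have hpρ := hS.p_lt_ρ x hx
  have hρ0 : 0 < ρ x := hp0.trans hpρ
  have hGρ : G.ρ (s x, p x) = ρ x := (hS.energy x hx).symm
  have hR1 : 1 < G.ρp (s x, p x) := G.one_lt_ρp hw h1
  have hconv := G.ρp_convexity hw h1 (by rw [hGρ]; exact add_pos hρ0 hp0)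
  have hH2 := G.mul_ρp_lt hw hk h2
  have hne := G.mul_ρp_ne hw hk
  have hAs := G.fderiv_ρp_scaling hw
  have hRs := G.fderiv_ρ_scaling hw
  have hχ := hS.chiS_eq hV hg hVΩ hx
  have hπ : piS g x = p x / ρ x := by rw [piS, hS.rhoS_eq hg hVΩ hx, hS.pS_eq hg hVΩ hx]
  have hρpd := (G.contDiffAt_ρp hw).differentiableAt_infty
  have hs := (hS.contDiffAt_s hV hx).differentiableAt_infty
  have hp := (hS.contDiffAt_p hV hx).differentiableAt_infty
  have hρ := (hS.contDiffAt_ρ hV hx).differentiableAt_infty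
  -- Both `dχ` and `dπ` are multiples of the single form `p ds + k dp = k p d(s/k + ln p)`. This
  -- yields the wedge condition, and `χ'` as a ratio of coefficients.
  have hdχ : ∀ v, k * fderiv ℝ (chiS g) x v =
      -(fderiv ℝ G.ρp (s x, p x) (0, 1) / G.ρp (s x, p x) ^ 2) *
        (p x * fderiv ℝ s x v + k * fderiv ℝ p x v) := by
    intro v
    have e : chiS g =ᶠ[𝓝 x] fun y => 1 / G.ρp (s y, p y) := by
      filter_upwards [hV.mem_nhds hx] with y hy using hS.chiS_eq hV hg hVΩ hy
    have hd : DifferentiableAt ℝ (fun y => G.ρp (s y, p y)) x :=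
      DifferentiableAt.comp (f := fun y => (s y, p y)) x hρpd (hs.prodMk hp)
    rw [e.fderiv_eq, fderiv_div_apply (differentiableAt_const _) hd (by linarith),
      hS.fderiv_comp hV hx hρpd, fderiv_prod_apply]
    simp only [fderiv_fun_const, Pi.zero_apply, _root_.zero_apply]
    field_simp
    simp only at hAs
    linear_combination (-fderiv ℝ s x v) * hAs
  have hdπ : ∀ v, k * fderiv ℝ (piS g) x v =
      (ρ x - p x * G.ρp (s x, p x)) / ρ x ^ 2 *
        (p x * fderiv ℝ s x v + k * fderiv ℝ p x v) := by
    intro v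
    have e : piS g =ᶠ[𝓝 x] fun y => p y / ρ y := by
      filter_upwards [hV.mem_nhds hx] with y hy
      rw [piS, hS.rhoS_eq hg hVΩ hy, hS.pS_eq hg hVΩ hy]
    rw [e.fderiv_eq, fderiv_div_apply hp hρ hρ0.ne', hS.fderiv_energy hV hx, fderiv_prod_apply]
    change _ * ((_ - _ * (_ + _ * G.ρp (s x, p x))) / _) = _
    rw [hGρ] at hRs
    field_simp
    simp only at hRs
    linear_combination (-p x * fderiv ℝ s x v) * hRs
  rw [hGρ] at hconv hH2 hne
  simp only at hconv hH2 hne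
  set R := G.ρp (s x, p x) with hR
  set A := fderiv ℝ G.ρp (s x, p x) (0, 1) with hA
  have hR0 : 0 < R := by linarith
  have hu := hS.unit x hx
  obtain ⟨P, hP, hgP⟩ := hg.lorentz x (hVΩ hx)
  refine ⟨?_, ?_, ?_, ?_, ?_, ?_, ?_, ?_, ?_, ?_⟩
  · rw [hQ, hq]
    exact smul_vecMulVec_sq (hg.det (hVΩ hx)) hu _
  · intro v hv
    rw [hQ, bil_vecMulVec, ← bil_eq]
    have := lorentz_timelike_ne_zero hgP (u := u x) (by rw [hu]; norm_num) hv
    rw [mul_assoc]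
    exact mul_pos (by linarith) (mul_self_pos.2 this)
  · rw [ht, hq]; linarith
  · rw [ht, hq]; linarith
  · intro h0
    have h3 := congrArg (fun w => u x ⬝ᵥ w) h0
    simp only [dotProduct_zero] at h3
    rw [hQ, Matrix.smul_mulVec, Matrix.vecMulVec_mulVec,
      dotProduct_comm (g x *ᵥ u x) (raise g x _),
      raise_dotProduct (hg.det (hVΩ hx)) (hg.symm (hVΩ hx)), op_smul_eq_smul, dotProduct_smul,
      dotProduct_smul, ← bil_eq, hu] at h3
    have h4 : u x ⬝ᵥ dif (rhoS g) x = along u ρ x :=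
      along_congr (hS.rhoS_eventuallyEq hV hg hVΩ hx) u
    rw [h4] at h3
    have h5 := hS.nonisoenergetic x hx
    simp only [smul_eq_mul, mul_neg, mul_one, neg_eq_zero, mul_eq_zero] at h3
    rcases h3 with h3 | h3
    · linarith
    · exact h5 h3
  · intro i j
    have hk2 : k * k ≠ 0 := (mul_pos hk hk).ne'
    have e1 := hdχ (EuclideanSpace.single i 1)
    have e2 := hdχ (EuclideanSpace.single j 1)
    have e3 := hdπ (EuclideanSpace.single i 1)
    have e4 := hdπ (EuclideanSpace.single j 1)
    change k * pd i (chiS g) x = _ at e1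
    change k * pd j (chiS g) x = _ at e2
    change k * pd i (piS g) x = _ at e3
    change k * pd j (piS g) x = _ at e4
    have : k * k * (pd i (chiS g) x * pd j (piS g) x - pd j (chiS g) x * pd i (piS g) x) = 0 := by
      have : k * k * (pd i (chiS g) x * pd j (piS g) x - pd j (chiS g) x * pd i (piS g) x) =
        (k * pd i (chiS g) x) * (k * pd j (piS g) x) -
          (k * pd j (chiS g) x) * (k * pd i (piS g) x) := by ring
      rw [this, e1, e2, e3, e4]; ring
    exact (mul_eq_zero.1 this).resolve_left hk2
  · rw [hχ, hπ]
    intro h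
    field_simp at h
    exact hne (by linarith)
  · rw [hχ, hπ]
    have : p x / ρ x / (2 * (p x / ρ x) + 1) = p x / (2 * p x + ρ x) := by
      field_simp
    rw [this, div_lt_div_iff₀ (by positivity) hR0]
    linarith
  · rw [hχ, div_lt_one hR0]; exact hR1
  · intro y hy
    rw [sum_mul_pd] at hy
    rw [sum_mul_pd, sum_mul_pd]
    have e1 := hdχ (vec y)
    have e2 := hdπ (vec y)
    set η := p x * fderiv ℝ s x (vec y) + k * fderiv ℝ p x (vec y)
    have hη : η ≠ 0 := by
      intro h
      rw [h, mul_zero, mul_eq_zero] at e2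
      exact e2.elim hk.ne' hy
    have hne' : ρ x - p x * R ≠ 0 := sub_ne_zero.2 (Ne.symm hne)
    have hratio : fderiv ℝ (chiS g) x (vec y) / fderiv ℝ (piS g) x (vec y) =
        -A * ρ x ^ 2 / (R ^ 2 * (ρ x - p x * R)) := by
      rw [← mul_div_mul_left _ _ hk.ne', e1, e2]
      field_simp
    rw [hratio, hχ, hπ]
    -- The factor `χ - π` cancels the denominator `ρ - pR` of `χ'` whatever its sign, leaving the
    -- expression of `ρp_convexity` over `R³`.
    have : (1 + p x / ρ x) * (1 / R - p x / ρ x) * (-A * ρ x ^ 2 / (R ^ 2 * (ρ x - p x * R))) +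
        2 * (1 / R) * (1 - 1 / R) =
        (-((ρ x + p x) * A) + 2 * (R - 1) * R) / R ^ 3 := by
      field_simp
    rw [this]
    positivity

end IsIdealGasSolutionOn

/-! ### Functional dependence -/

theorem vec_coord (v : E4) : vec (fun i => v i) = v := by
  ext j
  simp [vec, Finset.sum_apply, Pi.single_apply]

theorem fderiv_proportional {f h : E4 → ℝ} {x : E4}
    (hw : ∀ i j, pd i f x * pd j h x - pd j f x * pd i h x = 0) (i : Fin 4) (v : E4) :
    fderiv ℝ f x v * pd i h x = pd i f x * fderiv ℝ h x v := by
  rw [← vec_coord v, ← sum_mul_pd, ← sum_mul_pd, Finset.sum_mul, Finset.mul_sum]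
  exact Finset.sum_congr rfl fun j _ => by linear_combination -(v j) * hw i j

/-- A function whose differential is proportional to the non vanishing one of another function
is locally a smooth function of the latter. -/
theorem exists_function_of {Ω : Set E4} (hΩ : IsOpen Ω) {f h : E4 → ℝ}
    (hf : ∀ x ∈ Ω, ContDiffAt ℝ ∞ f x) (hh : ∀ x ∈ Ω, ContDiffAt ℝ ∞ h x)
    (hw : ∀ x ∈ Ω, ∀ i j, pd i f x * pd j h x - pd j f x * pd i h x = 0)
    {y : E4} (hy : y ∈ Ω) {i : Fin 4} (hi : pd i h y ≠ 0) :
    ∃ X : ℝ → ℝ, (∀ᶠ t in 𝓝 (h y), ContDiffAt ℝ ∞ X t) ∧ ∀ᶠ x in 𝓝 y, f x = X (h x) := by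
  set e : E4 := EuclideanSpace.single i (1 : ℝ) with he
  have hei : e i = 1 := by simp [he]
  set c : E4 →L[ℝ] ℝ := EuclideanSpace.proj i with hc
  have hcv : ∀ v, c v = v i := fun _ => rfl
  -- `Φ` replaces the `i`-th coordinate by `h`; it is a local diffeomorphism wherever `∂ᵢh ≠ 0`. In
  -- the new coordinates `f` becomes `H`, to be shown independent of all coordinates but the `i`-th.
  set Φ : E4 → E4 := fun x => x + (h x - c x) • e with hΦ
  set Φ' : E4 → E4 →L[ℝ] E4 := fun x =>
    ContinuousLinearMap.id ℝ E4 + (fderiv ℝ h x - c).smulRight e with hΦ'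
  have hΦi : ∀ x, (Φ x) i = h x := fun x => by simp [hΦ, hei, hcv]
  have hΦ'i : ∀ x v, (Φ' x v) i = fderiv ℝ h x v := fun x v => by simp [hΦ', hei, hcv]
  have hsm : ∀ x ∈ Ω, ContDiffAt ℝ ∞ Φ x := fun x hx =>
    contDiffAt_id.add (((hh x hx).sub c.contDiff.contDiffAt).smul contDiffAt_const)
  have hder : ∀ x ∈ Ω, HasFDerivAt Φ (Φ' x) x := fun x hx =>
    (hasFDerivAt_id x).add (((hh x hx).differentiableAt_infty.hasFDerivAt.sub
      c.hasFDerivAt).smul_const e)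
  have hequiv : ∀ x, pd i h x ≠ 0 → ∃ E : E4 ≃L[ℝ] E4, (E : E4 →L[ℝ] E4) = Φ' x := by
    intro x hx
    have hinj : Function.Injective (Φ' x : E4 →ₗ[ℝ] E4) := by
      rw [injective_iff_map_eq_zero]
      intro v hv
      have hv' : v + (fderiv ℝ h x v - c v) • e = 0 := hv
      have h1 : fderiv ℝ h x v = 0 := by
        rw [← hΦ'i]; change ((Φ' x : E4 →ₗ[ℝ] E4) v) i = 0; rw [hv]; rfl
      rw [h1, zero_sub] at hv'
      have h2 := congrArg (fderiv ℝ h x) hv'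
      rw [map_add, map_smul, h1, map_zero, zero_add, smul_eq_mul, neg_mul, neg_eq_zero,
        mul_eq_zero] at h2
      rw [h2.resolve_right hx] at hv'
      simpa using hv'
    exact ⟨(LinearEquiv.ofInjectiveEndo _ hinj).toContinuousLinearEquiv, by ext v; rfl⟩
  obtain ⟨E, hE⟩ := hequiv y hi
  have hderE : HasFDerivAt Φ (E : E4 →L[ℝ] E4) y := hE ▸ hder y hy
  set φ := (hsm y hy).toOpenPartialHomeomorph Φ hderE (by simp) with hφ
  have hφc : (φ : E4 → E4) = Φ := rfl
  have hys : y ∈ φ.source := (hsm y hy).mem_toOpenPartialHomeomorph_source hderE (by simp)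
  have hyt : Φ y ∈ φ.target := φ.map_source hys
  have hsymy : φ.symm (Φ y) = y := φ.left_inv hys
  have hgood : ∀ᶠ x in 𝓝 y, x ∈ Ω ∧ pd i h x ≠ 0 :=
    (hΩ.eventually_mem hy).and ((contDiffAt_pd (hh y hy) i).continuousAt.eventually_ne hi)
  have hgood' : ∀ᶠ z in 𝓝 (Φ y), z ∈ φ.target ∧ (φ.symm z ∈ Ω ∧ pd i h (φ.symm z) ≠ 0) := by
    refine (φ.open_target.eventually_mem hyt).and ?_
    have := φ.symm.continuousAt (x := Φ y) hyt
    rw [ContinuousAt, hsymy] at this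
    exact this.eventually hgood
  obtain ⟨r, hr, hball⟩ := Metric.eventually_nhds_iff_ball.1 hgood'
  have hsymm : ∀ z ∈ Metric.ball (Φ y) r, ContDiffAt ℝ ∞ φ.symm z ∧
      ∀ v, Φ' (φ.symm z) (fderiv ℝ φ.symm z v) = v := by
    intro z hz
    obtain ⟨hzt, hzΩ, hzi⟩ := hball z hz
    obtain ⟨E', hE'⟩ := hequiv _ hzi
    have hd : HasFDerivAt φ (E' : E4 →L[ℝ] E4) (φ.symm z) := hE' ▸ hder _ hzΩ
    refine ⟨φ.contDiffAt_symm hzt hd (hsm _ hzΩ), fun v => ?_⟩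
    rw [(φ.hasFDerivAt_symm hzt hd).fderiv, ← hE']
    simp
  set H : E4 → ℝ := fun z => f (φ.symm z) with hH
  have hHs : ∀ z ∈ Metric.ball (Φ y) r, ContDiffAt ℝ ∞ H z := fun z hz =>
    (hf _ (hball z hz).2.1).comp z (hsymm z hz).1
  -- A direction with zero `i`-th component is carried back to one annihilated by `dh`, hence by
  -- `df`, which is proportional to `dh`. Integrating along segments, which stay in the convex ball,
  -- gives `hconst`.
  have hHd : ∀ z ∈ Metric.ball (Φ y) r, ∀ v : E4, v i = 0 → fderiv ℝ H z v = 0 := by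
    intro z hz v hv
    obtain ⟨hzt, hzΩ, hzi⟩ := hball z hz
    have h1 : fderiv ℝ H z v = fderiv ℝ f (φ.symm z) (fderiv ℝ φ.symm z v) := by
      rw [hH, fderiv_fun_comp z (hf _ hzΩ).differentiableAt_infty
        (hsymm z hz).1.differentiableAt_infty]
      rfl
    have h2 := fderiv_proportional (hw _ hzΩ) i (fderiv ℝ φ.symm z v)
    rw [← hΦ'i, (hsymm z hz).2, hv, mul_zero] at h2
    rw [h1]
    exact (mul_eq_zero.1 h2).resolve_right hzi
  have hconst : ∀ z ∈ Metric.ball (Φ y) r, ∀ z' ∈ Metric.ball (Φ y) r, z i = z' i →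
      H z = H z' := by
    intro z hz z' hz' hi
    have hseg : ∀ t ∈ Set.Icc (0 : ℝ) 1, z + t • (z' - z) ∈ Metric.ball (Φ y) r :=
      fun t ht => (convex_ball _ _).add_smul_sub_mem hz hz' ht
    have hd : ∀ t ∈ Set.Icc (0 : ℝ) 1, HasDerivAt (fun t : ℝ => H (z + t • (z' - z))) 0 t := by
      intro t ht
      have hl : HasDerivAt (fun t : ℝ => z + t • (z' - z)) (z' - z) t := by
        simpa using ((hasDerivAt_id t).smul_const (z' - z)).const_add z
      have := (hHs _ (hseg t ht)).differentiableAt_infty.hasFDerivAt.comp_hasDerivAt t hl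
      rwa [hHd _ (hseg t ht) _ (by simp [hi])] at this
    obtain ⟨t, -, ht⟩ := exists_hasDerivAt_eq_slope (fun t : ℝ => H (z + t • (z' - z)))
      (fun _ => 0) zero_lt_one (fun t ht => (hd t ht).continuousAt.continuousWithinAt)
      (fun t ht => hd t (Set.Ioo_subset_Icc_self ht))
    simp at ht
    linarith
  have hline : ∀ t, dist (Φ y + (t - h y) • e) (Φ y) = |t - h y| := fun t => by
    simp [dist_eq_norm, norm_smul, he]
  -- `X` is `H` on the line through `Φ y` parallel to the `i`-th axis, parametrized by that
  -- coordinate; since `e` is a unit vector the same radius serves on the line and in the ball.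
  refine ⟨fun t => H (Φ y + (t - h y) • e), ?_, ?_⟩
  · filter_upwards [Metric.ball_mem_nhds (h y) hr] with t ht
    have hmem : Φ y + (t - h y) • e ∈ Metric.ball (Φ y) r := by
      rw [Metric.mem_ball, hline]; exact ht
    have hl : ContDiffAt ℝ ∞ (fun t : ℝ => Φ y + (t - h y) • e) t :=
      contDiffAt_const.add ((contDiffAt_id.sub contDiffAt_const).smul contDiffAt_const)
    exact ContDiffAt.comp (g := H) t (hHs _ hmem) hl
  · filter_upwards [φ.open_source.mem_nhds hys,
      (hder y hy).continuousAt.preimage_mem_nhds (Metric.ball_mem_nhds (Φ y) hr),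
      (hh y hy).continuousAt.preimage_mem_nhds (Metric.ball_mem_nhds (h y) hr)] with x hx1 hx2 hx3
    have h1 : f x = H (Φ x) := by
      change f x = f (φ.symm (φ x)); rw [φ.left_inv hx1]
    rw [h1]
    refine hconst _ hx2 _ ?_ ?_
    · rw [Metric.mem_ball, hline]; exact hx3
    · simp [hΦi, hei]

/-! ### Ideal gases of given compressibility -/

/-- The conditions at the value `t` of `π` on the function `X` giving `χ = X(π)`. -/
structure Admissible (X : ℝ → ℝ) (t : ℝ) : Prop where
  contDiffAt : ContDiffAt ℝ ∞ X t
  pos : 0 < t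
  lower : t / (2 * t + 1) < X t
  upper : X t < 1
  ne : X t ≠ t
  convexity : 0 < (1 + t) * (X t - t) * deriv X t + 2 * X t * (1 - X t)

namespace Admissible

variable {X : ℝ → ℝ} {t : ℝ} (h : Admissible X t)
include h

theorem X_pos : 0 < X t := lt_trans (div_pos h.pos (by linarith [h.pos])) h.lower

theorem lower' : t < (2 * t + 1) * X t := by
  have := h.lower
  rw [div_lt_iff₀ (by linarith [h.pos])] at this
  linarith

theorem eventually (hX : ∀ᶠ s in 𝓝 t, ContDiffAt ℝ ∞ X s) : ∀ᶠ s in 𝓝 t, Admissible X s := by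
  have hc := h.contDiffAt.continuousAt
  have hd : ContinuousAt (deriv X) t := by
    have := ((h.contDiffAt.fderiv_right (m := ∞) (by simp)).clm_apply
      (contDiffAt_const (c := (1 : ℝ)))).continuousAt
    exact this
  have hid : ContinuousAt (fun s : ℝ => s) t := continuousAt_id
  have h0 : 2 * t + 1 ≠ 0 := by linarith [h.pos]
  have e1 : ContinuousAt (fun s : ℝ => s / (2 * s + 1)) t :=
    hid.div ((continuousAt_const.mul hid).add continuousAt_const) h0
  have e2 : ContinuousAt (fun s => (1 + s) * (X s - s) * deriv X s + 2 * X s * (1 - X s)) t := by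
    fun_prop
  filter_upwards [hX, eventually_gt_nhds h.pos, e1.eventually_lt hc h.lower,
    hc.eventually_lt continuousAt_const h.upper, (hc.sub hid).eventually_ne (sub_ne_zero.2 h.ne),
    continuousAt_const.eventually_lt e2 h.convexity] with s a1 a2 a3 a4 a5 a6
  exact ⟨a1, a2, a3, a4, sub_ne_zero.1 a5, a6⟩

end Admissible

theorem exists_primitive {f : ℝ → ℝ} {c r : ℝ} (hr : 0 < r)
    (hf : ContDiffOn ℝ ∞ f (Metric.ball c r)) :
    ∃ F : ℝ → ℝ, ContDiffOn ℝ ∞ F (Metric.ball c r) ∧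
      ∀ t ∈ Metric.ball c r, HasDerivAt F (f t) t := by
  have hd : ∀ t ∈ Metric.ball c r, HasDerivAt (fun t => ∫ x in c..t, f x) (f t) t := by
    intro t ht
    have hsub : Set.uIcc c t ⊆ Metric.ball c r :=
      (convex_ball c r).ordConnected.uIcc_subset (Metric.mem_ball_self hr) ht
    exact intervalIntegral.integral_hasDerivAt_right
      (hf.continuousOn.mono hsub).intervalIntegrable
      (hf.continuousOn.stronglyMeasurableAtFilter Metric.isOpen_ball t ht)
      (hf.continuousOn.continuousAt (Metric.isOpen_ball.mem_nhds ht))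
  refine ⟨_, ?_, hd⟩
  rw [contDiffOn_infty_iff_deriv_of_isOpen Metric.isOpen_ball]
  exact ⟨fun t ht => (hd t ht).differentiableAt.differentiableWithinAt,
    hf.congr fun t ht => (hd t ht).deriv⟩

/-- The thermodynamic profiles, as functions of `σ = s / k + ln p`, of a gas with `χ = X(π)`:
`P` is `π`, and `F` is the enthalpy index. -/
structure Profile (X : ℝ → ℝ) (J : Set ℝ) (P F : ℝ → ℝ) : Prop where
  isOpen : IsOpen J
  smooth_P : ContDiffOn ℝ ∞ P J
  smooth_F : ContDiffOn ℝ ∞ F J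
  admissible : ∀ σ ∈ J, Admissible X (P σ)
  -- At fixed entropy `dσ = dp/p`, and `p d(p/ρ)/dp = π(1 - πρ'ₚ)` with `ρ'ₚ = 1/χ`.
  deriv_P : ∀ σ ∈ J, HasDerivAt P (P σ * (X (P σ) - P σ) / X (P σ)) σ
  -- For the enthalpy index `f`, `df = Θ ds + v dp = pv dσ`, and `pv/f = p/(ρ + p) = π/(1 + π)`.
  deriv_F : ∀ σ ∈ J, HasDerivAt F (F σ * (P σ / (1 + P σ))) σ
  F_pos : ∀ σ ∈ J, 0 < F σ

/-- The equation for `P` is autonomous, so it is solved by quadrature: `B` is a primitive of the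
reciprocal of its right-hand side, which does not vanish because `X t ≠ t`, and `P` is a local
inverse of `B`. Then `F` is the exponential of a primitive of `P/(1 + P)`. `B` is kept in the
conclusion because it recovers `σ`, hence the entropy, from `π`. -/
theorem exists_profile {X : ℝ → ℝ} {a : ℝ} (hX : ∀ᶠ t in 𝓝 a, ContDiffAt ℝ ∞ X t)
    (ha : Admissible X a) : ∃ J P F, Profile X J P F ∧ ∃ B : ℝ → ℝ, ∀ᶠ t in 𝓝 a,
      ContDiffAt ℝ ∞ B t ∧ HasDerivAt B (X t / (t * (X t - t))) t ∧ B t ∈ J ∧ P (B t) = t := by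
  obtain ⟨r, hr, hadm⟩ := Metric.eventually_nhds_iff_ball.1 (ha.eventually hX)
  have hb : ContDiffOn ℝ ∞ (fun t => X t / (t * (X t - t))) (Metric.ball a r) := fun t ht => by
    have h := hadm t ht
    exact (h.contDiffAt.div (contDiffAt_id.mul (h.contDiffAt.sub contDiffAt_id))
      (mul_ne_zero h.pos.ne' (sub_ne_zero.2 h.ne))).contDiffWithinAt
  have hb0 : ∀ t ∈ Metric.ball a r, X t / (t * (X t - t)) ≠ 0 := fun t ht => by
    have h := hadm t ht
    exact div_ne_zero h.X_pos.ne' (mul_ne_zero h.pos.ne' (sub_ne_zero.2 h.ne))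
  obtain ⟨B, hBs, hBd⟩ := exists_primitive hr hb
  have hBs' : ∀ t ∈ Metric.ball a r, ContDiffAt ℝ ∞ B t :=
    fun t ht => hBs.contDiffAt (Metric.isOpen_ball.mem_nhds ht)
  have haa := Metric.mem_ball_self (x := a) hr
  have hBE := (hBd a haa).hasFDerivAt_equiv (hb0 a haa)
  set φ := (hBs' a haa).toOpenPartialHomeomorph B hBE (by simp) with hφ
  have has : a ∈ φ.source := (hBs' a haa).mem_toOpenPartialHomeomorph_source hBE (by simp)
  have hat : B a ∈ φ.target := φ.map_source has
  have hsyma : φ.symm (B a) = a := φ.left_inv has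
  have hgood : ∀ᶠ σ in 𝓝 (B a), σ ∈ φ.target ∧ φ.symm σ ∈ Metric.ball a r := by
    refine (φ.open_target.eventually_mem hat).and ?_
    have := φ.symm.continuousAt (x := B a) hat
    rw [ContinuousAt, hsyma] at this
    exact this.eventually (Metric.ball_mem_nhds a hr)
  obtain ⟨r', hr', hJ⟩ := Metric.eventually_nhds_iff_ball.1 hgood
  have hPs : ContDiffOn ℝ ∞ φ.symm (Metric.ball (B a) r') := fun σ hσ =>
    (φ.contDiffAt_symm_deriv (hb0 _ (hJ σ hσ).2) (hJ σ hσ).1 (hBd _ (hJ σ hσ).2)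
      (hBs' _ (hJ σ hσ).2)).contDiffWithinAt
  have hcs : ContDiffOn ℝ ∞ (fun σ => φ.symm σ / (1 + φ.symm σ)) (Metric.ball (B a) r') :=
    hPs.div (contDiffOn_const.add hPs) fun σ hσ => by
      have := (hadm _ (hJ σ hσ).2).pos; positivity
  obtain ⟨L, hLs, hLd⟩ := exists_primitive hr' hcs
  refine ⟨Metric.ball (B a) r', φ.symm, fun σ => Real.exp (L σ),
    ⟨Metric.isOpen_ball, hPs, hLs.exp, fun σ hσ => hadm _ (hJ σ hσ).2, fun σ hσ => ?_,
      fun σ hσ => (hLd σ hσ).exp, fun σ _ => Real.exp_pos _⟩, B, ?_⟩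
  · have := φ.hasDerivAt_symm (hJ σ hσ).1 (hb0 _ (hJ σ hσ).2) (hBd _ (hJ σ hσ).2)
    rwa [inv_div] at this
  · filter_upwards [Metric.ball_mem_nhds a hr, φ.open_source.mem_nhds has,
      (hBs' a haa).continuousAt.preimage_mem_nhds (Metric.ball_mem_nhds (B a) hr')]
      with t ht hts htJ
    exact ⟨hBs' t ht, hBd t ht, htJ, φ.left_inv hts⟩

/-- The combination `σ = s / k + ln p` of the entropy and the pressure. -/
def entropyPressure (k : ℝ) (w : ℝ × ℝ) : ℝ := w.1 / k + Real.log w.2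

theorem contDiffAt_entropyPressure (k : ℝ) {w : ℝ × ℝ} (hw : 0 < w.2) :
    ContDiffAt ℝ ∞ (entropyPressure k) w :=
  (contDiffAt_fst.div_const k).add (contDiffAt_snd.log hw.ne')

theorem fderiv_entropyPressure (k : ℝ) {w : ℝ × ℝ} (hw : 0 < w.2) (h : ℝ × ℝ) :
    fderiv ℝ (entropyPressure k) w h = h.1 / k + h.2 / w.2 := by
  have h1 : HasFDerivAt (entropyPressure k)
      (k⁻¹ • ContinuousLinearMap.fst ℝ ℝ ℝ + w.2⁻¹ • ContinuousLinearMap.snd ℝ ℝ ℝ) w := by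
    have := (hasFDerivAt_fst (𝕜 := ℝ) (p := w)).mul_const k⁻¹
    exact (by simpa only [div_eq_mul_inv] using this : HasFDerivAt (fun w : ℝ × ℝ => w.1 / k) _ w).add
      ((hasFDerivAt_snd (𝕜 := ℝ) (p := w)).log hw.ne')
  rw [h1.fderiv]
  simp [div_eq_inv_mul]

theorem fderiv_comp_entropyPressure (k : ℝ) {w : ℝ × ℝ} (hw : 0 < w.2) {f : ℝ → ℝ} {f' : ℝ}
    (hf : HasDerivAt f f' (entropyPressure k w)) (h : ℝ × ℝ) :
    fderiv ℝ (fun y => f (entropyPressure k y)) w h = f' * (h.1 / k + h.2 / w.2) := by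
  have := hf.comp_hasFDerivAt w (contDiffAt_entropyPressure k hw).differentiableAt_infty.hasFDerivAt
  have h2 := this.fderiv
  change fderiv ℝ (fun y => f (entropyPressure k y)) w = _ at h2
  rw [h2, _root_.smul_apply, fderiv_entropyPressure k hw, smul_eq_mul]

theorem hasDerivAt_comp_entropyPressure_fst (k : ℝ) {w : ℝ × ℝ} {f : ℝ → ℝ} {f' : ℝ}
    (hf : HasDerivAt f f' (entropyPressure k w)) :
    HasDerivAt (fun s => f (entropyPressure k (s, w.2))) (f' / k) w.1 := by
  have h1 : HasDerivAt (fun s => entropyPressure k (s, w.2)) (1 / k) w.1 :=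
    ((hasDerivAt_id' w.1).div_const k).add_const (Real.log w.2)
  have := HasDerivAt.comp (h₂ := f) (h := fun s => entropyPressure k (s, w.2)) w.1 hf h1
  rwa [mul_one_div] at this

theorem hasDerivAt_comp_entropyPressure_snd (k : ℝ) {w : ℝ × ℝ} (hw : 0 < w.2) {f : ℝ → ℝ}
    {f' : ℝ} (hf : HasDerivAt f f' (entropyPressure k w)) :
    HasDerivAt (fun p => f (entropyPressure k (w.1, p))) (f' / w.2) w.2 := by
  have h1 : HasDerivAt (fun p => entropyPressure k (w.1, p)) (w.2⁻¹) w.2 :=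
    (Real.hasDerivAt_log hw.ne').const_add (w.1 / k)
  exact HasDerivAt.comp (h₂ := f) (h := fun p => entropyPressure k (w.1, p)) w.2 hf h1

namespace Profile

variable {X : ℝ → ℝ} {J : Set ℝ} {P F : ℝ → ℝ} (h : Profile X J P F)

/-- The states of the gas of given profiles. -/
def states (k : ℝ) (J : Set ℝ) : Set (ℝ × ℝ) := {w | 0 < w.2 ∧ entropyPressure k w ∈ J}

include h

theorem isOpen_states (k : ℝ) : IsOpen (states k J) := by
  rw [isOpen_iff_mem_nhds]
  rintro w ⟨hw1, hw2⟩
  have h1 : ∀ᶠ y in 𝓝 w, 0 < y.2 := continuousAt_snd.eventually_const_lt hw1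
  exact h1.and ((contDiffAt_entropyPressure k hw1).continuousAt.eventually
    (h.isOpen.eventually_mem hw2))

theorem factor_pos {σ : ℝ} (hσ : σ ∈ J) : 0 < P σ / (1 + P σ) := by
  have := (h.admissible σ hσ).pos
  positivity

theorem hasDerivAt_factor {σ : ℝ} (hσ : σ ∈ J) : HasDerivAt (fun σ => P σ / (1 + P σ))
    (P σ * (X (P σ) - P σ) / X (P σ) / (1 + P σ) ^ 2) σ := by
  have hp := (h.admissible σ hσ).pos
  have hd := h.deriv_P σ hσ
  refine (hd.fun_div (hd.const_add 1) (by positivity)).congr_deriv ?_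
  ring

theorem hasDerivAt_X {σ : ℝ} (hσ : σ ∈ J) : HasDerivAt (fun σ => X (P σ))
    (deriv X (P σ) * (P σ * (X (P σ) - P σ) / X (P σ))) σ :=
  HasDerivAt.comp (h₂ := X) (h := P) σ
    (h.admissible σ hσ).contDiffAt.differentiableAt_infty.hasDerivAt (h.deriv_P σ hσ)

theorem contDiffAt_P {σ : ℝ} (hσ : σ ∈ J) : ContDiffAt ℝ ∞ P σ :=
  h.smooth_P.contDiffAt (h.isOpen.mem_nhds hσ)

theorem contDiffAt_F {σ : ℝ} (hσ : σ ∈ J) : ContDiffAt ℝ ∞ F σ :=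
  h.smooth_F.contDiffAt (h.isOpen.mem_nhds hσ)

theorem contDiffAt_Fd {σ : ℝ} (hσ : σ ∈ J) :
    ContDiffAt ℝ ∞ (fun σ => F σ * (P σ / (1 + P σ))) σ := by
  have := (h.admissible σ hσ).pos
  exact (h.contDiffAt_F hσ).mul ((h.contDiffAt_P hσ).div
    (contDiffAt_const.add (h.contDiffAt_P hσ)) (by positivity))

theorem Fd_pos {σ : ℝ} (hσ : σ ∈ J) : 0 < F σ * (P σ / (1 + P σ)) :=
  mul_pos (h.F_pos σ hσ) (h.factor_pos hσ)

theorem energy_eq {w : ℝ × ℝ} {k : ℝ} (hw : w ∈ states k J) :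
    w.2 / (F (entropyPressure k w) * (P (entropyPressure k w) / (1 + P (entropyPressure k w)))) *
      (1 + (F (entropyPressure k w) - 1 -
        F (entropyPressure k w) * (P (entropyPressure k w) / (1 + P (entropyPressure k w))))) =
    w.2 / P (entropyPressure k w) := by
  have h1 := (h.admissible _ hw.2).pos
  have h2 := h.F_pos _ hw.2
  field_simp
  ring

/-- The ideal gas of given profiles. -/
def gas {k : ℝ} (hk : 0 < k) : IdealGas k where
  dom := states k J
  -- The product `A = F·P/(1 + P)` plays the role of `pv`. So `r = p/A`, `Θ = A/k` by the equation
  -- of state, and `ε = F - 1 - A` because `F = 1 + ε + pv`.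
  r w := w.2 / (F (entropyPressure k w) * (P (entropyPressure k w) / (1 + P (entropyPressure k w))))
  ε w := F (entropyPressure k w) - 1 -
    F (entropyPressure k w) * (P (entropyPressure k w) / (1 + P (entropyPressure k w)))
  Θ w := F (entropyPressure k w) * (P (entropyPressure k w) / (1 + P (entropyPressure k w))) / k
  isOpen_dom := h.isOpen_states k
  smooth_r w hw := (contDiffAt_snd.div (ContDiffAt.comp (g := fun σ => F σ * (P σ / (1 + P σ))) w
    (h.contDiffAt_Fd hw.2) (contDiffAt_entropyPressure k hw.1))
    (h.Fd_pos hw.2).ne').contDiffWithinAt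
  smooth_ε w hw := (ContDiffAt.comp (g := fun σ => F σ - 1 - F σ * (P σ / (1 + P σ))) w
    (((h.contDiffAt_F hw.2).sub contDiffAt_const).sub (h.contDiffAt_Fd hw.2))
    (contDiffAt_entropyPressure k hw.1)).contDiffWithinAt
  smooth_Θ w hw := (ContDiffAt.comp (g := fun σ => F σ * (P σ / (1 + P σ)) / k) w
    ((h.contDiffAt_Fd hw.2).div_const k)
    (contDiffAt_entropyPressure k hw.1)).contDiffWithinAt
  r_pos w hw := div_pos hw.1 (h.Fd_pos hw.2)
  Θ_pos w hw := div_pos (h.Fd_pos hw.2) hk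
  balance w hw v := by
    have hd := ((h.contDiffAt_Fd hw.2).differentiableAt_infty).hasDerivAt
    have hF := h.deriv_F _ hw.2
    set D := deriv (fun σ => F σ * (P σ / (1 + P σ))) (entropyPressure k w)
    have hw0 := hw.1
    simp only [one_div_div]
    rw [fderiv_comp_entropyPressure k hw0 (f := fun σ => F σ - 1 - F σ * (P σ / (1 + P σ)))
      ((hF.sub_const 1).sub hd), fderiv_div_apply
      (f := fun w => F (entropyPressure k w) *
        (P (entropyPressure k w) / (1 + P (entropyPressure k w))))
      (ContDiffAt.comp (g := fun σ => F σ * (P σ / (1 + P σ))) w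
        (h.contDiffAt_Fd hw.2) (contDiffAt_entropyPressure k hw.1)).differentiableAt_infty
      differentiableAt_snd hw0.ne', fderiv_snd_apply,
      fderiv_comp_entropyPressure k hw0 (f := fun σ => F σ * (P σ / (1 + P σ))) hd]
    -- `dε + p dv = dF - dA + p d(A/p) = A dσ - A dp/p = A ds/k`: the derivative `D` of `A` cancels,
    -- so it is never computed.
    generalize F (entropyPressure k w) *
        (P (entropyPressure k w) / (1 + P (entropyPressure k w))) = A
    field_simp
    ring
  ideal w hw := by
    have := (h.Fd_pos hw.2).ne'
    generalize F (entropyPressure k w) *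
        (P (entropyPressure k w) / (1 + P (entropyPressure k w))) = A at *
    field_simp
  nonbarotropic w hw := by
    have hadm := h.admissible _ hw.2
    have e : (fun s => w.2 / P (entropyPressure k (s, w.2))) =ᶠ[𝓝 w.1] fun s =>
        w.2 / (F (entropyPressure k (s, w.2)) * (P (entropyPressure k (s, w.2)) /
          (1 + P (entropyPressure k (s, w.2))))) * (1 + (F (entropyPressure k (s, w.2)) - 1 -
          F (entropyPressure k (s, w.2)) * (P (entropyPressure k (s, w.2)) /
          (1 + P (entropyPressure k (s, w.2)))))) := by
      have hc : ContinuousAt (fun s : ℝ => (s, w.2)) w.1 := by fun_prop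
      filter_upwards [hc.eventually ((h.isOpen_states k).eventually_mem hw)] with s hs
      exact (h.energy_eq hs).symm
    rw [← e.deriv_eq]
    have hd := (hasDerivAt_const w.1 w.2).fun_div
      (hasDerivAt_comp_entropyPressure_fst k (h.deriv_P _ hw.2)) hadm.pos.ne'
    rw [hd.deriv]
    have h1 := hadm.X_pos
    have h2 := hadm.pos
    have h3 := hw.1
    have h4 := sub_ne_zero.2 hadm.ne
    rw [zero_mul, zero_sub]
    refine div_ne_zero (neg_ne_zero.2 (mul_ne_zero h3.ne' ?_)) (by positivity)
    exact div_ne_zero (div_ne_zero (mul_ne_zero h2.ne' h4) h1.ne') hk.ne'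

theorem gas_ρ {k : ℝ} (hk : 0 < k) {w : ℝ × ℝ} (hw : w ∈ states k J) :
    (h.gas hk).ρ w = w.2 / P (entropyPressure k w) := h.energy_eq hw

theorem gas_τ {k : ℝ} (hk : 0 < k) {w : ℝ × ℝ} (hw : w ∈ states k J) :
    (h.gas hk).τ w = F (entropyPressure k w) ^ 2 *
      (P (entropyPressure k w) / (1 + P (entropyPressure k w))) / w.2 := by
  have hw0 : 0 < w.2 := hw.1
  have hA := (h.Fd_pos hw.2).ne'
  simp only [IdealGas.τ, IdealGas.v, gas, one_div_div]
  rw [mul_div_cancel₀ _ hw0.ne']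
  ring

/-- `τ = F²·P/(1 + P)/p` depends on `s` through `σ` only, and by the equations of the profile its
derivative has the sign of `(2π + 1)χ - π`. -/
theorem gas_H2 {k : ℝ} (hk : 0 < k) : (h.gas hk).H2 := by
  intro w hw
  have hw' : w ∈ states k J := hw
  have hadm := h.admissible _ hw'.2
  have hF := h.F_pos _ hw'.2
  have e : (fun s => (h.gas hk).τ (s, w.2)) =ᶠ[𝓝 w.1]
      fun s => (fun σ => F σ ^ 2 * (P σ / (1 + P σ))) (entropyPressure k (s, w.2)) / w.2 := by
    have hc : ContinuousAt (fun s : ℝ => (s, w.2)) w.1 := by fun_prop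
    filter_upwards [hc.eventually ((h.isOpen_states k).eventually_mem hw')] with s hs
    exact h.gas_τ hk hs
  rw [e.deriv_eq]
  have hd := (hasDerivAt_comp_entropyPressure_fst k
    (((h.deriv_F _ hw'.2).fun_pow 2).fun_mul (h.hasDerivAt_factor hw'.2))).div_const w.2
  rw [hd.deriv]
  have h1 := hadm.X_pos
  have h2 := hadm.pos
  have h3 := hadm.lower'
  have h4 : 0 < w.2 := hw'.1
  refine div_pos (div_pos ?_ hk) h4
  generalize F (entropyPressure k w) = f at *
  generalize P (entropyPressure k w) = t at *
  generalize X t = x at *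
  have : ((2 : ℕ) : ℝ) * f ^ (2 - 1) * (f * (t / (1 + t))) * (t / (1 + t)) +
      f ^ 2 * (t * (x - t) / x / (1 + t) ^ 2) =
      f ^ 2 * t * ((2 * t + 1) * x - t) / (x * (1 + t) ^ 2) := by
    field_simp
    push_cast
    ring
  rw [this]
  have h5 := sub_pos.2 h3
  positivity

theorem gas_H1 {k : ℝ} (hk : 0 < k) : (h.gas hk).H1 := by
  intro w hw
  have hw' : w ∈ states k J := hw
  have hF := h.F_pos _ hw'.2
  -- `U` is chosen so that `τ'ₚ = -U(σ)/p²`; its positivity is `χ < 1`.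
  set U : ℝ → ℝ := fun σ => F σ ^ 2 * (P σ / (1 + P σ)) ^ 2 * (1 - X (P σ)) / X (P σ) with hU
  have hUpos : ∀ σ ∈ J, 0 < U σ := fun σ hσ => by
    have := (h.admissible σ hσ).X_pos
    have := sub_pos.2 (h.admissible σ hσ).upper
    have := h.factor_pos hσ
    have := h.F_pos σ hσ
    simp only [hU]; positivity
  have hτ : ∀ w ∈ states k J, deriv (fun p => (h.gas hk).τ (w.1, p)) w.2 =
      -(U (entropyPressure k w) / w.2 ^ 2) := by
    intro w hw'
    have hadm := h.admissible _ hw'.2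
    have e : (fun p => (h.gas hk).τ (w.1, p)) =ᶠ[𝓝 w.2]
        fun p => (fun σ => F σ ^ 2 * (P σ / (1 + P σ))) (entropyPressure k (w.1, p)) / p := by
      have hc : ContinuousAt (fun p : ℝ => (w.1, p)) w.2 := by fun_prop
      filter_upwards [hc.eventually ((h.isOpen_states k).eventually_mem hw')] with s hs
      exact h.gas_τ hk hs
    have hw0 : 0 < w.2 := hw'.1
    have hd := (hasDerivAt_comp_entropyPressure_snd k hw'.1
      (((h.deriv_F _ hw'.2).fun_pow 2).fun_mul (h.hasDerivAt_factor hw'.2))).fun_div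
      (hasDerivAt_id' w.2) hw0.ne'
    rw [e.deriv_eq, hd.deriv]
    have h1 := hadm.X_pos
    have h2 := hadm.pos
    simp only [hU]
    change ((_ / _ * _ - F (entropyPressure k w) ^ 2 * (P (entropyPressure k w) /
      (1 + P (entropyPressure k w))) * _) / _ : ℝ) = _
    generalize F (entropyPressure k w) = f at *
    generalize P (entropyPressure k w) = t at *
    generalize X t = x at *
    field_simp
    push_cast
    ring
  constructor
  · rw [hτ w hw', neg_lt_zero]
    have := hUpos _ hw'.2
    have h0 : 0 < w.2 := hw'.1
    positivity
  · have e : deriv (fun p => (h.gas hk).τ (w.1, p)) =ᶠ[𝓝 w.2]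
        fun p => -(U (entropyPressure k (w.1, p)) / p ^ 2) := by
      have hc : ContinuousAt (fun p : ℝ => (w.1, p)) w.2 := by fun_prop
      filter_upwards [hc.eventually ((h.isOpen_states k).eventually_mem hw')] with p hp
      exact hτ (w.1, p) hp
    have hadm := h.admissible _ hw'.2
    have hw0 : 0 < w.2 := hw'.1
    -- Since `τ''ₚ = (2U - U')/p³`, the derivative is displayed as `2U` minus a positive multiple of
    -- the admissible expression in `χ'`.
    have hUd : HasDerivAt U (U (entropyPressure k w) * 2 -
        F (entropyPressure k w) ^ 2 * (P (entropyPressure k w) / (1 + P (entropyPressure k w))) ^ 3 /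
        X (P (entropyPressure k w)) ^ 3 * ((1 + P (entropyPressure k w)) *
          (X (P (entropyPressure k w)) - P (entropyPressure k w)) *
          deriv X (P (entropyPressure k w)) +
          2 * X (P (entropyPressure k w)) * (1 - X (P (entropyPressure k w)))))
        (entropyPressure k w) := by
      have hX := h.hasDerivAt_X hw'.2
      refine (((((h.deriv_F _ hw'.2).fun_pow 2).fun_mul
        ((h.hasDerivAt_factor hw'.2).fun_pow 2)).fun_mul (hX.const_sub 1)).fun_div hX
        hadm.X_pos.ne').congr_deriv ?_
      have h1 := hadm.X_pos
      have h2 := hadm.pos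
      simp only [hU]
      generalize F (entropyPressure k w) = f at *
      generalize P (entropyPressure k w) = t at *
      generalize deriv X t = x' at *
      generalize X t = x at *
      have h3 : 1 + t ≠ 0 := by positivity
      simp only [Nat.cast_ofNat, Nat.reduceSub, pow_one]
      field_simp
      ring
    have hd := ((hasDerivAt_comp_entropyPressure_snd k hw'.1 hUd).fun_div
      (hasDerivAt_pow 2 w.2) (by positivity)).fun_neg
    rw [e.deriv_eq, hd.deriv]
    have h1 := hadm.X_pos
    have h2 := hadm.pos
    have h3 := hadm.convexity
    change 0 < (-((_ / _ * _ - U (entropyPressure k w) * _) / _) : ℝ)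
    generalize U (entropyPressure k w) = V at *
    generalize F (entropyPressure k w) = f at *
    generalize P (entropyPressure k w) = t at *
    generalize (1 + t) * (X t - t) * deriv X t + 2 * X t * (1 - X t) = C at *
    generalize X t = x at *
    have : -(((V * 2 - f ^ 2 * (t / (1 + t)) ^ 3 / x ^ 3 * C) / w.2 * w.2 ^ 2 -
        V * (((2 : ℕ) : ℝ) * w.2 ^ (2 - 1))) / (w.2 ^ 2) ^ 2) =
        f ^ 2 * (t / (1 + t)) ^ 3 / x ^ 3 * C / w.2 ^ 3 := by
      field_simp
      push_cast
      ring
    rw [this]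
    positivity

end Profile

/-! ### The Rainich conditions yield an ideal gas solution -/

/-- The cube root is not smooth at zero, but `q > 0` forces the argument in the definition of `q` to
be negative. -/
theorem contDiffAt_cbrt {a : ℝ} (ha : a < 0) : ContDiffAt ℝ ∞ cbrt a := by
  have e : (fun a : ℝ => -(-a) ^ ((1 : ℝ) / 3)) =ᶠ[𝓝 a] cbrt := by
    filter_upwards [eventually_lt_nhds ha] with b hb
    rw [cbrt, Real.sign_of_neg hb, abs_of_neg hb]; ring
  refine ContDiffAt.congr_of_eventuallyEq ?_ e.symm
  exact (contDiffAt_id.neg.rpow_const_of_ne (neg_ne_zero.2 ha.ne)).neg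

theorem contDiffAt_bil {S : Tensor2} {v w : E4 → Fin 4 → ℝ} {x : E4} (hS : SmoothM S x)
    (hv : ∀ i, ContDiffAt ℝ ∞ (fun y => v y i) x) (hw : ∀ i, ContDiffAt ℝ ∞ (fun y => w y i) x) :
    ContDiffAt ℝ ∞ (fun y => bil (S y) (v y) (w y)) x :=
  ContDiffAt.sum fun i _ => ContDiffAt.sum fun j _ => ((hS i j).mul (hv i)).mul (hw j)

/-- The vector field `Q(dρ)`, as a covector. -/
def fluxCovector (g : Tensor2) (x : E4) : Fin 4 → ℝ := tQ g x *ᵥ raise g x (dif (rhoS g) x)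

/-- The scalar `Q(dρ, dρ)`. -/
def fluxNorm (g : Tensor2) (x : E4) : ℝ :=
  bil (tQ g x) (raise g x (dif (rhoS g) x)) (raise g x (dif (rhoS g) x))

/-- The unit velocity of the fluid, in terms of the Ricci tensor. -/
def velocity (g : Tensor2) (x : E4) : Fin 4 → ℝ :=
  (Real.sqrt (qS g x * fluxNorm g x))⁻¹ • ((g x)⁻¹ *ᵥ fluxCovector g x)

namespace RainichConditions

variable {g : Tensor2} {x : E4}

theorem q_pos (h : RainichConditions g x) : 0 < qS g x := by
  have := h.neg_q_lt_t; have := h.t_le_q; linarith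

theorem rho_pos (h : RainichConditions g x) : 0 < rhoS g x := by
  have := h.neg_q_lt_t; have := h.q_pos; rw [rhoS]; linarith

theorem p_nonneg (h : RainichConditions g x) : 0 ≤ pS g x := by
  have := h.t_le_q; rw [pS]; linarith

theorem p_lt_rho (h : RainichConditions g x) : pS g x < rhoS g x := by
  have := h.neg_q_lt_t; rw [pS, rhoS]; linarith

variable {Ω : Set E4} (hg : IsLorentzOn g Ω) (hR : ∀ x ∈ Ω, RainichConditions g x) (hx : x ∈ Ω)
include hg hx

omit hx in
theorem _root_.Rainich.IsLorentzOn.smooth_tN (hx : x ∈ Ω) : SmoothM (tN g) x :=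
  (hg.smooth_ricci hx).sub (SmoothM.smul ((hg.smooth_tS hx).div_const 4) (hg.smooth x hx))

include hR

theorem smooth_qS : ContDiffAt ℝ ∞ (qS g) x := by
  have hM : SmoothM (fun y => (g y)⁻¹ * tN g y) x := (hg.smooth_inv hx).mul (hg.smooth_tN hx)
  have h3 : ContDiffAt ℝ ∞ (fun y => (((g y)⁻¹ * tN g y) ^ 3).trace / 3) x := by
    simp only [pow_succ, pow_zero, Matrix.one_mul]
    exact ((hM.mul hM).mul hM).trace.div_const 3
  have hneg : (((g x)⁻¹ * tN g x) ^ 3).trace / 3 < 0 := by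
    have h0 := (hR x hx).q_pos
    rw [qS] at h0
    rw [← cbrt_pow_three ((((g x)⁻¹ * tN g x) ^ 3).trace / 3)]
    exact Odd.pow_neg (by decide) (by linarith)
  exact contDiffAt_const.mul (ContDiffAt.comp (g := cbrt) x (contDiffAt_cbrt hneg) h3)

theorem smooth_rhoS : ContDiffAt ℝ ∞ (rhoS g) x :=
  ((contDiffAt_const.mul (smooth_qS hg hR hx)).add (hg.smooth_tS hx)).div_const 4

theorem smooth_pS : ContDiffAt ℝ ∞ (pS g) x :=
  ((smooth_qS hg hR hx).sub (hg.smooth_tS hx)).div_const 4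

theorem smooth_tQ : SmoothM (tQ g) x :=
  (hg.smooth_tN hx).sub (SmoothM.smul ((smooth_qS hg hR hx).div_const 4) (hg.smooth x hx))

theorem smooth_piS : ContDiffAt ℝ ∞ (piS g) x :=
  (smooth_pS hg hR hx).div (smooth_rhoS hg hR hx) (hR x hx).rho_pos.ne'

omit hR in
theorem smooth_raise {f : E4 → ℝ} (hf : ContDiffAt ℝ ∞ f x) (i : Fin 4) :
    ContDiffAt ℝ ∞ (fun y => raise g y (dif f y) i) x :=
  contDiffAt_mulVec (hg.smooth_inv hx) (fun j => contDiffAt_pd hf j) i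

theorem smooth_fluxNorm : ContDiffAt ℝ ∞ (fluxNorm g) x :=
  contDiffAt_bil (smooth_tQ hg hR hx) (smooth_raise hg hx (smooth_rhoS hg hR hx))
    (smooth_raise hg hx (smooth_rhoS hg hR hx))

omit hR in
theorem tQ_symm : (tQ g x)ᵀ = tQ g x := by
  simp only [tQ, tN, Matrix.transpose_sub, Matrix.transpose_smul, hg.ricci_symm hx, hg.symm hx]

omit hR in
theorem trace_tQ : ((g x)⁻¹ * tQ g x).trace = -qS g x := by
  simp only [tQ, tN, Matrix.mul_sub, Matrix.mul_smul, hg.inv_mul hx, Matrix.trace_sub,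
    Matrix.trace_smul, Matrix.trace_one, Fintype.card_fin, smul_eq_mul]
  rw [← tS]
  push_cast
  ring

/-- A time-like `z` has `Q(z,z) > 0`, so the rank-one form exhibits `Q` as a positive multiple of a
square; such a form is positive on every vector outside its kernel, in particular on `dρ`. -/
theorem fluxNorm_pos : 0 < fluxNorm g x := by
  have h := hR x hx
  obtain ⟨P, hP, hgP⟩ := hg.lorentz x hx
  obtain ⟨z, hz⟩ := lorentz_exists_timelike hP hgP
  have hm := h.timelike_pos z hz
  have hQ := eq_vecMulVec_of_projector (hg.det hx) (tQ_symm hg hx) h.q_pos.ne'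
    (trace_tQ hg hx) h.algebraic (z := z) (by rw [← bil_eq]; exact hm.ne')
  have hne := h.Q_drho_ne
  rw [← bil_eq] at hQ
  set v := raise g x (dif (rhoS g) x) with hv
  rw [hQ, Matrix.smul_mulVec, Matrix.vecMulVec_mulVec] at hne
  have hne' : v ⬝ᵥ tQ g x *ᵥ z ≠ 0 := by
    intro h0
    rw [dotProduct_comm] at h0
    simp [h0] at hne
  rw [fluxNorm, ← hv, hQ, bil_vecMulVec, mul_assoc]
  exact mul_pos (inv_pos.2 hm) (mul_self_pos.2 hne')

theorem smooth_velocity (a : Fin 4) : ContDiffAt ℝ ∞ (fun y => velocity g y a) x := by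
  have h0 : 0 < qS g x * fluxNorm g x := mul_pos (hR x hx).q_pos (fluxNorm_pos hg hR hx)
  have h1 : ContDiffAt ℝ ∞ (fun y => (Real.sqrt (qS g y * fluxNorm g y))⁻¹) x :=
    (((smooth_qS hg hR hx).mul (smooth_fluxNorm hg hR hx)).sqrt h0.ne').inv (Real.sqrt_pos.2 h0).ne'
  exact h1.mul (contDiffAt_mulVec (hg.smooth_inv hx) (contDiffAt_mulVec (smooth_tQ hg hR hx)
    (smooth_raise hg hx (smooth_rhoS hg hR hx))) a)

omit hR in
theorem lower_velocity : g x *ᵥ velocity g x =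
    (Real.sqrt (qS g x * fluxNorm g x))⁻¹ • fluxCovector g x := by
  rw [velocity, Matrix.mulVec_smul, Matrix.mulVec_mulVec, hg.mul_inv hx, Matrix.one_mulVec]

theorem sqrt_inv_sq : (Real.sqrt (qS g x * fluxNorm g x))⁻¹ *
    (Real.sqrt (qS g x * fluxNorm g x))⁻¹ = (qS g x * fluxNorm g x)⁻¹ := by
  rw [← mul_inv, Real.mul_self_sqrt (mul_pos (hR x hx).q_pos (fluxNorm_pos hg hR hx)).le]

theorem tQ_eq : tQ g x = qS g x • vecMulVec (g x *ᵥ velocity g x) (g x *ᵥ velocity g x) := by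
  have h := hR x hx
  have hD := fluxNorm_pos hg hR hx
  have hq := h.q_pos
  have hQ := eq_vecMulVec_of_projector (hg.det hx) (tQ_symm hg hx) hq.ne'
    (trace_tQ hg hx) h.algebraic (z := raise g x (dif (rhoS g) x))
    (by rw [← bil_eq]; exact hD.ne')
  rw [lower_velocity hg hx, Matrix.smul_vecMulVec, Matrix.vecMulVec_smul, smul_smul, smul_smul,
    mul_assoc, sqrt_inv_sq hg hR hx]
  rw [← bil_eq, ← fluxNorm, ← fluxCovector] at hQ
  conv_lhs => rw [hQ]
  congr 1
  field_simp

/-- The normalization in `velocity` is dictated by `Q² = -qQ`: the covector `Q(dρ)` has squared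
length `-q Q(dρ, dρ)`. -/
theorem unit_velocity : bil (g x) (velocity g x) (velocity g x) = -1 := by
  have h := hR x hx
  have hD := fluxNorm_pos hg hR hx
  have hq := h.q_pos
  have h1 : (g x)⁻¹ *ᵥ fluxCovector g x ⬝ᵥ fluxCovector g x = -(qS g x * fluxNorm g x) := by
    have hQQ : tQ g x * (g x)⁻¹ * tQ g x = -(qS g x • tQ g x) :=
      eq_neg_of_add_eq_zero_left h.algebraic
    rw [fluxNorm, bil_eq, fluxCovector, Matrix.dotProduct_mulVec, ← Matrix.mulVec_transpose,
      tQ_symm hg hx, Matrix.mulVec_mulVec, Matrix.mulVec_mulVec, hQQ,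
      Matrix.neg_mulVec, Matrix.smul_mulVec, neg_dotProduct, smul_dotProduct, smul_eq_mul,
      dotProduct_comm]
  rw [bil_eq, lower_velocity hg hx, velocity, smul_dotProduct, dotProduct_smul, h1]
  simp only [smul_eq_mul]
  rw [← mul_assoc, sqrt_inv_sq hg hR hx]
  field_simp

theorem along_velocity_rho : along (velocity g) (rhoS g) x ≠ 0 := by
  have hD := fluxNorm_pos hg hR hx
  have h0 : 0 < qS g x * fluxNorm g x := mul_pos (hR x hx).q_pos hD
  have h1 : along (velocity g) (rhoS g) x =
      (Real.sqrt (qS g x * fluxNorm g x))⁻¹ * fluxNorm g x := by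
    change velocity g x ⬝ᵥ dif (rhoS g) x = _
    rw [← raise_dotProduct (hg.det hx) (hg.symm hx), lower_velocity hg hx, dotProduct_smul,
      smul_eq_mul]
    exact congrArg _ (bil_eq _ _ _).symm
  rw [h1]
  exact (mul_pos (inv_pos.2 (Real.sqrt_pos.2 h0)) hD).ne'

theorem einstein_velocity : ricci g x - (tS g x / 2) • g x = (rhoS g x + pS g x) •
    vecMulVec (g x *ᵥ velocity g x) (g x *ᵥ velocity g x) + pS g x • g x := by
  have e : rhoS g x + pS g x = qS g x := by rw [rhoS, pS]; ring
  rw [e, ← tQ_eq hg hR hx, tQ, tN, pS]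
  module

theorem smooth_chiS : ContDiffAt ℝ ∞ (chiS g) x :=
  (contDiffAt_bil (smooth_tQ hg hR hx) (smooth_raise hg hx (smooth_pS hg hR hx))
    (smooth_raise hg hx (smooth_rhoS hg hR hx))).div (smooth_fluxNorm hg hR hx)
    (fluxNorm_pos hg hR hx).ne'

theorem along_velocity_p : along (velocity g) (pS g) x =
    chiS g x * along (velocity g) (rhoS g) x := by
  have h0 := along_velocity_rho hg hR hx
  rw [chiS_eq (hg.det hx) (hg.symm hx) (hR x hx).q_pos.ne' (tQ_eq hg hR hx) h0]
  field_simp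

/-- Only `p ≥ 0` is assumed, but on an open set. A zero of `p` would be a local minimum, so `dp = 0`
there; then `χ u(ρ) = u(p) = 0` gives `χ = 0 = π`, which is excluded. -/
theorem p_pos : 0 < pS g x := by
  refine lt_of_le_of_ne (hR x hx).p_nonneg fun h0 => ?_
  have hmin : IsLocalMin (pS g) x := by
    filter_upwards [hg.mem_nhds hx] with y hy
    rw [← h0]; exact (hR y hy).p_nonneg
  have hd := hmin.fderiv_eq_zero
  have hu : along (velocity g) (pS g) x = 0 := by rw [along_eq, hd]; rfl
  rw [along_velocity_p hg hR hx] at hu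
  have h2 := (mul_eq_zero.1 hu).resolve_right (along_velocity_rho hg hR hx)
  have h3 := (hR x hx).chi_ne_pi
  rw [h2, piS, ← h0, zero_div] at h3
  exact h3 rfl

theorem along_velocity_pi : along (velocity g) (piS g) x =
    (chiS g x - piS g x) * along (velocity g) (rhoS g) x / rhoS g x := by
  have hρ := (hR x hx).rho_pos
  have h1 := along_velocity_p hg hR hx
  rw [along_eq] at h1 ⊢
  change fderiv ℝ (fun y => pS g y / rhoS g y) x _ = _
  rw [fderiv_div_apply (smooth_pS hg hR hx).differentiableAt_infty
    (smooth_rhoS hg hR hx).differentiableAt_infty hρ.ne', h1, ← along_eq, piS]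
  field_simp

theorem exists_pd_pi_ne : ∃ i, pd i (piS g) x ≠ 0 := by
  by_contra! h0
  have h1 := along_velocity_pi hg hR hx
  rw [along, Finset.sum_eq_zero fun a _ => by rw [h0, mul_zero]] at h1
  refine div_ne_zero (mul_ne_zero (sub_ne_zero.2 (hR x hx).chi_ne_pi)
    (along_velocity_rho hg hR hx)) (hR x hx).rho_pos.ne' h1.symm

theorem admissible {X : ℝ → ℝ} (hX : ContDiffAt ℝ ∞ X (piS g x))
    (h : ∀ᶠ y in 𝓝 x, chiS g y = X (piS g y)) : Admissible X (piS g x) := by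
  have hx0 := h.self_of_nhds
  have hRx := hR x hx
  obtain ⟨i, hi⟩ := exists_pd_pi_ne hg hR hx
  refine ⟨hX, div_pos (p_pos hg hR hx) hRx.rho_pos, hx0 ▸ hRx.lt_chi, hx0 ▸ hRx.chi_lt_one,
    hx0 ▸ hRx.chi_ne_pi, ?_⟩
  -- Tested on a coordinate vector along which `π` varies, the quotient defining `χ'` is the
  -- derivative of `X` at `π`.
  have h1 := hRx.chi_prime (Pi.single i 1) (by simpa [Pi.single_apply] using hi)
  have h2 : pd i (chiS g) x = deriv X (piS g x) * pd i (piS g) x := by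
    rw [pd_congr h]
    have := (hX.differentiableAt_infty.hasDerivAt.comp_hasFDerivAt x
      (smooth_piS hg hR hx).differentiableAt_infty.hasFDerivAt).fderiv
    change fderiv ℝ (fun y => X (piS g y)) x = _ at this
    rw [pd, this]; rfl
  simp only [Pi.single_apply, ite_mul, one_mul, zero_mul, Finset.sum_ite_eq', Finset.mem_univ,
    if_true] at h1
  rwa [h2, mul_div_cancel_right₀ _ hi, hx0] at h1

theorem modelsIdealGasNear {k : ℝ} (hk : 0 < k) : ModelsIdealGasNear k g Ω x := by
  obtain ⟨i, hi⟩ := exists_pd_pi_ne hg hR hx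
  obtain ⟨X, hX, hχX⟩ := exists_function_of hg.isOpen (f := chiS g) (h := piS g)
    (fun y hy => smooth_chiS hg hR hy) (fun y hy => smooth_piS hg hR hy)
    (fun y hy => (hR y hy).wedge) hx hi
  obtain ⟨J, P, F, hprof, B, hB⟩ := exists_profile hX (admissible hg hR hx hX.self_of_nhds hχX)
  have hev : ∀ᶠ y in 𝓝 x, y ∈ Ω ∧ chiS g y = X (piS g y) ∧
      ContDiffAt ℝ ∞ B (piS g y) ∧
      HasDerivAt B (X (piS g y) / (piS g y * (X (piS g y) - piS g y))) (piS g y) ∧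
      B (piS g y) ∈ J ∧ P (B (piS g y)) = piS g y :=
    (hg.isOpen.eventually_mem hx).and
      (hχX.and ((smooth_piS hg hR hx).continuousAt.eventually hB))
  obtain ⟨V, hV, hVo, hxV⟩ := eventually_nhds_iff.1 hev
  have hVΩ : V ⊆ Ω := fun y hy => (hV y hy).1
  -- The entropy is found by solving `s/k + ln p = B(π)`, so that the state of the fluid lies on the
  -- profile and `P` returns `π`.
  set s : E4 → ℝ := fun y => k * (B (piS g y) - Real.log (pS g y)) with hs
  have hσ : ∀ y, entropyPressure k (s y, pS g y) = B (piS g y) := fun y => by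
    simp only [entropyPressure, hs]; field_simp; ring
  have hstate : ∀ y ∈ V, (s y, pS g y) ∈ Profile.states k J := fun y hy =>
    ⟨p_pos hg hR (hVΩ hy), by rw [hσ]; exact (hV y hy).2.2.2.2.1⟩
  have hBs : ∀ y ∈ V, ContDiffAt ℝ ∞ (fun y => B (piS g y)) y := fun y hy =>
    ContDiffAt.comp (g := B) y (hV y hy).2.2.1 (smooth_piS hg hR (hVΩ hy))
  have hss : ∀ y ∈ V, ContDiffAt ℝ ∞ s y := fun y hy =>
    contDiffAt_const.mul ((hBs y hy).sub
      ((smooth_pS hg hR (hVΩ hy)).log (p_pos hg hR (hVΩ hy)).ne'))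
  have henergy : ∀ y ∈ V, rhoS g y = (hprof.gas hk).ρ (s y, pS g y) := fun y hy => by
    rw [hprof.gas_ρ hk (hstate y hy), hσ, (hV y hy).2.2.2.2.2, piS]
    have := p_pos hg hR (hVΩ hy)
    have := (hR y (hVΩ hy)).rho_pos
    field_simp
  -- `B'(π) u(π) = χ/(π(χ - π)) · (χ - π)u(ρ)/ρ = χ u(ρ)/p = u(p)/p`, so the two terms of `u(s)`
  -- cancel.
  have hentropy : ∀ y ∈ V, fderiv ℝ s y (vec (velocity g y)) = 0 := by
    intro y hy
    obtain ⟨hyΩ, hyX, hyB, hyB', -, -⟩ := hV y hy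
    have hp := p_pos hg hR hyΩ
    have hρ := (hR y hyΩ).rho_pos
    have hπd := (smooth_piS hg hR hyΩ).differentiableAt_infty
    have hpd := (smooth_pS hg hR hyΩ).differentiableAt_infty
    have h1 := ((hyB'.comp_hasFDerivAt y hπd.hasFDerivAt).sub
      (hpd.hasFDerivAt.log hp.ne')).const_mul k
    have h2 : fderiv ℝ s y = _ := h1.fderiv
    have h3 := along_velocity_pi hg hR hyΩ
    have h4 := along_velocity_p hg hR hyΩ
    rw [along_eq] at h3 h4
    have h5 := sub_ne_zero.2 (hR y hyΩ).chi_ne_pi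
    rw [h2]
    simp only [_root_.smul_apply, _root_.sub_apply, smul_eq_mul]
    rw [h3, h4, ← hyX]
    have h6 : pS g y = piS g y * rhoS g y := by rw [piS]; field_simp
    have h7 : 0 < piS g y := div_pos hp hρ
    rw [h6]
    field_simp
    ring
  refine ⟨V, hVo, hxV, hVΩ, hprof.gas hk, velocity g, rhoS g, pS g, s, hprof.gas_H1 hk,
    hprof.gas_H2 hk, ?_⟩
  constructor
  · exact fun a y hy => (smooth_velocity hg hR (hVΩ hy) a).contDiffWithinAt
  · exact fun y hy => (smooth_rhoS hg hR (hVΩ hy)).contDiffWithinAt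
  · exact fun y hy => (smooth_pS hg hR (hVΩ hy)).contDiffWithinAt
  · exact fun y hy => (hss y hy).contDiffWithinAt
  · exact fun y hy => unit_velocity hg hR (hVΩ hy)
  · exact fun y hy => einstein_velocity hg hR (hVΩ hy)
  · exact fun y hy => (hR y (hVΩ hy)).p_nonneg
  · exact fun y hy => (hR y (hVΩ hy)).p_lt_rho
  · exact hstate
  · exact henergy
  · intro y hy
    have hyΩ := hVΩ hy
    set G := hprof.gas hk
    have hw : (s y, pS g y) ∈ G.dom := hstate y hy
    have hr := G.r_pos _ hw
    have hsd := (hss y hy).differentiableAt_infty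
    have hpd := (smooth_pS hg hR hyΩ).differentiableAt_infty
    have h1 := hg.energy_conservation hyΩ (smooth_velocity hg hR hyΩ)
      (smooth_rhoS hg hR hyΩ).differentiableAt_infty hpd
      (by filter_upwards [hg.mem_nhds hyΩ] with z hz using unit_velocity hg hR hz)
      (by filter_upwards [hg.mem_nhds hyΩ] with z hz using einstein_velocity hg hR hz)
    have e : rhoS g =ᶠ[𝓝 y] fun z => G.ρ (s z, pS g z) := by
      filter_upwards [hVo.mem_nhds hy] with z hz using henergy z hz
    have hpos : rhoS g y + pS g y ≠ 0 :=
      (add_pos (hR y hyΩ).rho_pos (p_pos hg hR hyΩ)).ne'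
    rw [along_eq, e.fderiv_eq, along_pair (G.contDiffAt_ρ hw).differentiableAt_infty hsd hpd,
      G.fderiv_ρ hw, ← henergy y hy, hentropy y hy] at h1
    rw [along_eq, along_pair (G.contDiffAt_r hw).differentiableAt_infty hsd hpd, hentropy y hy]
    simp only [mul_zero, add_zero] at h1
    -- With `u(s) = 0` in the Gibbs relation, conservation of energy is the nonzero factor `(ρ +
    -- p)/r` times conservation of matter.
    have h2 : (rhoS g y + pS g y) / G.r (s y, pS g y) *
        (fderiv ℝ G.r (s y, pS g y) (0, fderiv ℝ (pS g) y (vec (velocity g y))) +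
          G.r (s y, pS g y) * divergence g (velocity g) y) = 0 := by
      rw [mul_add, ← mul_assoc, div_mul_cancel₀ _ hr.ne', h1]
    exact (mul_eq_zero.1 h2).resolve_left (div_ne_zero hpos hr.ne')
  · exact fun y hy => along_velocity_rho hg hR (hVΩ hy)

end RainichConditions

/-! ### Charts -/

/-- The derivative of a chart is invertible, so the coordinate vectors form a basis; `P` is its
matrix of components in an orthonormal frame. -/
theorem LorentzMetric.isLorentzOn_coord {M : Type*} [TopologicalSpace M] [ChartedSpace E4 M]
    [IsManifold (𝓡 4) ∞ M] (g : LorentzMetric M) {c : OpenPartialHomeomorph M E4}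
    (hc : c ∈ IsManifold.maximalAtlas (𝓡 4) ∞ M) : IsLorentzOn (g.coord c) c.target where
  isOpen := c.open_target
  smooth y hy i j := (g.smooth c hc i j).contDiffAt (c.open_target.mem_nhds hy)
  lorentz y hy := by
    obtain ⟨b, hb⟩ := g.signature (c.symm y)
    have hM : c.MDifferentiable (𝓡 4) (𝓡 4) :=
      ⟨(contMDiffOn_of_mem_maximalAtlas hc).mdifferentiableOn (by simp),
        (contMDiffOn_symm_of_mem_maximalAtlas hc).mdifferentiableOn (by simp)⟩
    let T : E4 ≃ₗ[ℝ] TangentSpace (𝓡 4) (c.symm y) := (hM.symm.mfderiv hy).toLinearEquiv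
    let e : Module.Basis (Fin 4) ℝ (TangentSpace (𝓡 4) (c.symm y)) :=
      (EuclideanSpace.basisFun (Fin 4) ℝ).toBasis.map T
    have he : ∀ i, e i = coordVec c y i := fun i => by
      simp only [e, Module.Basis.map_apply, OrthonormalBasis.coe_toBasis,
        EuclideanSpace.basisFun_apply]
      rfl
    refine ⟨b.toMatrix e, ?_, ?_⟩
    · exact (Matrix.isUnit_iff_isUnit_det _).1
        (IsUnit.of_mul_eq_one _ (b.toMatrix_mul_toMatrix_flip e))
    · ext i j
      have hexp : ∀ i, coordVec c y i = ∑ a, b.toMatrix e a i • b a := fun i => by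
        rw [← he, Module.Basis.sum_toMatrix_smul_self]
      change g.inner (c.symm y) (coordVec c y i) (coordVec c y j) = _
      rw [hexp i, hexp j]
      simp only [map_sum, LinearMap.sum_apply, map_smul, LinearMap.smul_apply, hb, smul_eq_mul,
        Matrix.mul_apply, Matrix.transpose_apply, Finset.mul_sum, Finset.sum_mul]
      exact Finset.sum_congr rfl fun _ _ => Finset.sum_congr rfl fun _ _ => by ring

end Rainich

end

/-- Both implications are applied chart by chart. The converse uses the conditions on the whole
chart domain and not only at the point, since it differentiates the quantities they govern. -/
theorem theorem9 {M : Type*} [TopologicalSpace M] [ChartedSpace Rainich.E4 M]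
    [IsManifold (𝓡 4) ∞ M] (g : Rainich.LorentzMetric M) (k : ℝ) (hk : 0 < k) :
    g.ModelsIdealGas k ↔ g.SatisfiesRainich := by
  refine ⟨fun h c hc y hy => ?_, fun h c hc y hy => ?_⟩
  · obtain ⟨V, hV, hyV, hVt, G, u, ρ, p, s, h1, h2, hS⟩ := h c hc y hy
    exact hS.rainich hV (g.isLorentzOn_coord hc) hVt hyV hk h1 h2
  · exact Rainich.RainichConditions.modelsIdealGasNear (g.isLorentzOn_coord hc) (h c hc) hy hk
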